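/- Let $\kappa$ be an infinite regular ordinal. **Classes of maps.** Let $\mathcal M$ be a class of maps in a category $\mathcal E$. For an ordinal $\alpha$, an *$\alpha$-chain in $\mathcal M$* is a functor $D\colon\alpha\to\mathcal E$ that is cocontinuous (for every limit ordinal $\beta<\alpha$, $D(\beta)$ is the colimit of the $D(\gamma)$, $\gamma<\beta$) and whose successor maps $D(\beta)\to D(\beta+1)$ lie in $\mathcal M$; its colimit is its *$\alpha$-transfinite composition*. We say that $(\mathcal E,\mathcal M)$ *has $\kappa$-compositions* if $\mathcal M$ contains the identities and is closed under composition and, for every limit ordinal $0<\alpha\le\kappa$, every $\alpha$-chain $D$ in $\mathcal M$ has a colimit whose coprojections lie in $\mathcal M$ and such that, for every cocone $D\to X$ with all legs in $\mathcal M$, the induced map $\operatorname{colim}D\to X$ lies in $\mathcal M$. We say that $(\mathcal E,\mathcal M)$ *has pushouts* if the pushout of every map in $\mathcal M$ along every map exists and $\mathcal M$ is stable under pushout. A functor *preserves $\kappa$-compositions* if it preserves the colimits of $\alpha$-chains in $\mathcal M$ for all limit ordinals $0<\alpha\le\kappa$; it *preserves pushouts* if it preserves pushouts along maps in $\mathcal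 M$. **Configurations.** The category $\operatorname{ConfMnd}_{\mathrm p}^{\kappa}$ has as objects the triples $(\mathcal E,\mathcal M,F)$ of a category $\mathcal E$, a class $\mathcal M$ of maps in $\mathcal E$ and a pointed endofunctor $(F,\eta\colon\mathrm{Id}\to F)$ of $\mathcal E$ such that 1. $(\mathcal E,\mathcal M)$ has $\kappa$-compositions; 2. $(\mathcal E,\mathcal M)$ has pushouts; 3. all components of $\eta$ lie in $\mathcal M$; 4. for every $f\colon A\to B$ in $\mathcal M$, the map $B+_A FA\to FB$ induced by $\eta_B$ and $Ff$ lies in $\mathcal M$ (closure under Leibniz application of $\eta$); 5. $F(\mathcal M)\subseteq\mathcal M$; 6. $F$ preserves $\kappa$-transfinite compositions of maps in $\mathcal M$, i.e. colimits of $\kappa$-chains in $\mathcal M$. A morphism $(\mathcal E_1,\mathcal M_1,F_1)\to(\mathcal E_2,\mathcal M_2,F_2)$ is a functor $P\colon\mathcal E_1\to\mathcal E_2$ with $P(\mathcal M_1)\subseteq\mathcal M_2$ that preserves $\kappa$-compositions and pushouts, together with a natural isomorphism $\varphi\colon F_2P\simeq PF_1$ such that $\varphi\circ\eta_2P=P\eta_1$.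 **Functors and adjunctions.** An object of the category $\operatorname{Fun}_s$ is a functor $F\colon\mathcal C\to\mathcal D$ between two categories; a morphism from $F$ to $F'\colon\mathcal C'\to\mathcal D'$ consists of functors $U\colon\mathcal C\to\mathcal C'$ and $V\colon\mathcal D\to\mathcal D'$ and a natural isomorphism $VF\simeq F'U$. An object of the category $\operatorname{Adju}_s$ consists of functors $F\colon\mathcal C\to\mathcal D$ and $G\colon\mathcal D\to\mathcal C$ with an adjunction $F\dashv G$ given by a unit $\eta$ and a counit $\epsilon$; a morphism to $(\mathcal C',\mathcal D',F',G',\eta',\epsilon')$ consists of functors $U\colon\mathcal C\to\mathcal C'$ and $V\colon\mathcal D\to\mathcal D'$ and natural isomorphisms $\alpha\colon F'U\simeq VF$ and $\beta\colon UG\simeq G'V$ with $\beta F\circ U\eta=G'\alpha\circ\eta'U$ and $V\epsilon\circ\alpha G=\epsilon'V\circ F'\beta$. The restriction functor $\operatorname{Adju}_s\to\operatorname{Fun}_s$ to the right adjoint sends an object to $G$ and a morphism to $(V,U,\beta)$. **Algebras.** For a pointed endofunctor $(F,\eta)$ of $\mathcal E$, let $\operatorname{alg}(F)$ be the category of objects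 $A\in\mathcal E$ with a map $a\colon FA\to A$ such that $a\circ\eta_A=\mathrm{id}_A$, with morphisms the maps commuting with the structure maps. Sending $(\mathcal E,\mathcal M,F)$ to the forgetful functor $\operatorname{alg}(F)\to\mathcal E$, and a morphism $(P,\varphi)$ to the functor $(A,a)\mapsto(PA,\,Pa\circ\varphi_A)$ lying strictly over $P$, defines a functor $\operatorname{ConfMnd}_{\mathrm p}^{\kappa}\to\operatorname{Fun}_s$. **Theorem.** The functor $\operatorname{ConfMnd}_{\mathrm p}^{\kappa}\to\operatorname{Fun}_s$ sending $(\mathcal E,\mathcal M,F)$ to the forgetful functor $\operatorname{alg}(F)\to\mathcal E$ lifts through the restriction functor $\operatorname{Adju}_s\to\operatorname{Fun}_s$ to the right adjoint: there is a functor $\operatorname{ConfMnd}_{\mathrm p}^{\kappa}\to\operatorname{Adju}_s$ whose composite with $\operatorname{Adju}_s\to\operatorname{Fun}_s$ is equal to it. In particular, free $F$-algebras exist for every configuration $(\mathcal E,\mathcal M,F)$, and every morphism of configurations preserves them. -/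

import Mathlib

open CategoryTheory Limits

universe w v u v₁ v₂ v₃ v₄ u₁ u₂ u₃ u₄

/-! ### The categories of functors and of adjunctions, with strong morphisms -/

/-- An object of the category of functors: a functor between two categories. -/
structure FunS : Type (max (v₁ + 1) (v₂ + 1) (u₁ + 1) (u₂ + 1)) where
  C : Type u₁
  D : Type u₂
  [catC : Category.{v₁} C]
  [catD : Category.{v₂} D]
  F : C ⥤ D

namespace FunS

attribute [instance] catC catD

/-- A strong morphism of functors: a square of functors commuting up to a specified
natural isomorphism. -/
structure Hom (X Y : FunS.{v₁, v₂, u₁, u₂}) : Type (max v₁ v₂ u₁ u₂) where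
  U : X.C ⥤ Y.C
  V : X.D ⥤ Y.D
  iso : X.F ⋙ V ≅ U ⋙ Y.F

theorem Hom.ext' {X Y : FunS.{v₁, v₂, u₁, u₂}} {U : X.C ⥤ Y.C} {V : X.D ⥤ Y.D}
    {i j : X.F ⋙ V ≅ U ⋙ Y.F} (h : ∀ A, i.hom.app A = j.hom.app A) :
    Hom.mk U V i = Hom.mk U V j := by
  have : i = j := by ext A; exact h A
  rw [this]

instance : Category FunS.{v₁, v₂, u₁, u₂} where
  Hom := Hom
  id X := ⟨𝟭 _, 𝟭 _, NatIso.ofComponents (fun _ => Iso.refl _)⟩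
  comp {X Y Z} f g :=
    ⟨f.U ⋙ g.U, f.V ⋙ g.V,
      NatIso.ofComponents (fun A => g.V.mapIso (f.iso.app A) ≪≫ g.iso.app (f.U.obj A))
        (fun {A B} m => by
          have h₁ := congrArg g.V.map (f.iso.hom.naturality m)
          have h₂ := g.iso.hom.naturality (f.U.map m)
          simp only [Functor.comp_map, Functor.map_comp] at h₁ h₂
          simp only [Functor.comp_map, Iso.trans_hom, Functor.mapIso_hom, Iso.app_hom,
            Category.assoc]
          rw [← Category.assoc, h₁, Category.assoc, h₂])⟩
  id_comp f := Hom.ext' (fun A => by simp)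
  comp_id f := Hom.ext' (fun A => by simp)
  assoc f g h := Hom.ext' (fun A => by simp)

end FunS

/-- An object of the category of adjunctions: functors `F : C ⥤ D` and `G : D ⥤ C` with a unit
and a counit that satisfy the triangle identities. -/
structure AdjuS : Type (max (v₁ + 1) (v₂ + 1) (u₁ + 1) (u₂ + 1)) where
  C : Type u₁
  D : Type u₂
  [catC : Category.{v₁} C]
  [catD : Category.{v₂} D]
  F : C ⥤ D
  G : D ⥤ C
  adj : F ⊣ G

namespace AdjuS

attribute [instance] catC catD

/-- A strong morphism of adjunctions: functors `U`, `V` commuting with the left adjoints and with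
the right adjoints up to specified isomorphisms, compatibly with the units and the counits. -/
structure Hom (X Y : AdjuS.{v₁, v₂, u₁, u₂}) : Type (max v₁ v₂ u₁ u₂) where
  U : X.C ⥤ Y.C
  V : X.D ⥤ Y.D
  α : U ⋙ Y.F ≅ X.F ⋙ V
  β : X.G ⋙ U ≅ V ⋙ Y.G
  unit : ∀ A : X.C,
    U.map (X.adj.unit.app A) ≫ β.hom.app (X.F.obj A) =
      Y.adj.unit.app (U.obj A) ≫ Y.G.map (α.hom.app A)
  counit : ∀ B : X.D,
    α.hom.app (X.G.obj B) ≫ V.map (X.adj.counit.app B) =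
      Y.F.map (β.hom.app B) ≫ Y.adj.counit.app (V.obj B)

theorem Hom.ext' {X Y : AdjuS.{v₁, v₂, u₁, u₂}} {f g : Hom X Y} (hU : f.U = g.U) (hV : f.V = g.V)
    (hα : f.α ≍ g.α) (hβ : f.β ≍ g.β) : f = g := by
  cases f; cases g
  cases hU; cases hV; cases hα; cases hβ
  rfl

/-- The identity morphism. -/
def Hom.id (X : AdjuS.{v₁, v₂, u₁, u₂}) : Hom X X where
  U := 𝟭 _
  V := 𝟭 _
  α := NatIso.ofComponents (fun _ => Iso.refl _)
  β := NatIso.ofComponents (fun _ => Iso.refl _)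
  unit A := by simp
  counit B := by simp

/-- Composition of morphisms: horizontal pasting of the squares. -/
def Hom.comp {X Y Z : AdjuS.{v₁, v₂, u₁, u₂}} (f : Hom X Y) (g : Hom Y Z) : Hom X Z where
  U := f.U ⋙ g.U
  V := f.V ⋙ g.V
  α := NatIso.ofComponents (fun A => g.α.app (f.U.obj A) ≪≫ g.V.mapIso (f.α.app A))
    (fun {A B} m => by
      have h₁ := congrArg g.V.map (f.α.hom.naturality m)
      have h₂ := g.α.hom.naturality (f.U.map m)
      simp only [Functor.comp_map, Functor.map_comp] at h₁ h₂
      simp only [Functor.comp_map, Iso.trans_hom, Functor.mapIso_hom, Iso.app_hom, Category.assoc]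
      rw [← Category.assoc, h₂, Category.assoc, h₁])
  β := NatIso.ofComponents (fun B => g.U.mapIso (f.β.app B) ≪≫ g.β.app (f.V.obj B))
    (fun {A B} m => by
      have h₁ := congrArg g.U.map (f.β.hom.naturality m)
      have h₂ := g.β.hom.naturality (f.V.map m)
      simp only [Functor.comp_map, Functor.map_comp] at h₁ h₂
      simp only [Functor.comp_map, Iso.trans_hom, Functor.mapIso_hom, Iso.app_hom, Category.assoc]
      rw [← Category.assoc, h₁, Category.assoc, h₂])
  unit A := by
    have h₁ := congrArg g.U.map (f.unit A)
    have h₂ := g.unit (f.U.obj A)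
    have h₃ := g.β.hom.naturality (f.α.hom.app A)
    simp only [Functor.comp_obj, Functor.comp_map, Functor.map_comp] at h₁ h₂ h₃
    simp only [Functor.comp_obj, Functor.comp_map, NatIso.ofComponents_hom_app, Iso.trans_hom,
      Functor.mapIso_hom, Iso.app_hom, Functor.map_comp]
    rw [← Category.assoc, h₁, Category.assoc, h₃, ← Category.assoc, h₂, Category.assoc]
  counit B := by
    have h₁ := congrArg g.V.map (f.counit B)
    have h₂ := g.counit (f.V.obj B)
    have h₃ := g.α.hom.naturality (f.β.hom.app B)
    simp only [Functor.comp_obj, Functor.comp_map, Functor.map_comp] at h₁ h₂ h₃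
    simp only [Functor.comp_obj, Functor.comp_map, NatIso.ofComponents_hom_app, Iso.trans_hom,
      Functor.mapIso_hom, Iso.app_hom, Functor.map_comp, Category.assoc]
    rw [h₁, ← Category.assoc, ← h₃, Category.assoc, h₂]

instance : Category AdjuS.{v₁, v₂, u₁, u₂} where
  Hom := Hom
  id := Hom.id
  comp := Hom.comp
  id_comp f := Hom.ext' rfl rfl
    (heq_of_eq (by ext A; simp [Hom.comp, Hom.id])) (heq_of_eq (by ext A; simp [Hom.comp, Hom.id]))
  comp_id f := Hom.ext' rfl rfl
    (heq_of_eq (by ext A; simp [Hom.comp, Hom.id])) (heq_of_eq (by ext A; simp [Hom.comp, Hom.id]))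
  assoc f g h := Hom.ext' rfl rfl
    (heq_of_eq (by ext A; simp [Hom.comp])) (heq_of_eq (by ext A; simp [Hom.comp]))

/-- The restriction functor that sends an adjunction to its right adjoint. -/
def rightAdjoint : AdjuS.{v₁, v₂, u₁, u₂} ⥤ FunS.{v₂, v₁, u₂, u₁} where
  obj X := ⟨X.D, X.C, X.G⟩
  map f := ⟨f.V, f.U, f.β⟩
  map_id _ := rfl
  map_comp _ _ := rfl

end AdjuS

/-! ### Categories with a class of maps: transfinite compositions and pushouts -/

section ClassesOfMaps

variable {E : Type u} [Category.{v} E] (M : MorphismProperty E)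

/-- A cocontinuous diagram of shape the ordinal `α` (the poset of ordinals below `α`) whose
successor maps are in `M`. -/
structure IsMapChain {α : Ordinal.{w}} (D : Set.Iio α ⥤ E) : Prop where
  continuous : D.IsWellOrderContinuous
  succ_mem : ∀ {i j : Set.Iio α} (h : i ⋖ j), M (D.map (homOfLE h.le))

/-- `(E, M)` has `κ`-compositions: `M` is closed under finitary composition, and for every limit
ordinal `α ≤ κ`, every `α`-chain of maps in `M` has a colimit that is also its colimit in the wide
subcategory of maps in `M`. -/
structure HasCompositions (κ : Ordinal.{w}) : Prop where
  multiplicative : M.IsMultiplicative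
  exists_colimit : ∀ α : Ordinal.{w}, α ≤ κ → Order.IsSuccLimit α →
    ∀ D : Set.Iio α ⥤ E, IsMapChain M D →
      ∃ (c : Cocone D) (hc : IsColimit c), (∀ i, M (c.ι.app i)) ∧
        ∀ s : Cocone D, (∀ i, M (s.ι.app i)) → M (hc.desc s)

/-- `(E, M)` has pushouts: pushouts along maps in `M` exist and `M` is stable under pushout. -/
structure HasPushoutsOfMaps : Prop where
  hasPushout : ∀ {A B C : E} (f : A ⟶ C) (g : A ⟶ B), M f → HasPushout f g
  stable : M.IsStableUnderCobaseChange

variable {E' : Type u₁} [Category.{v₁} E']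

/-- The functor `P` preserves `α`-transfinite compositions of maps in `M`. -/
def PreservesCompositions (α : Ordinal.{w}) (P : E ⥤ E') : Prop :=
  ∀ D : Set.Iio α ⥤ E, IsMapChain M D → PreservesColimit D P

/-- The functor `P` preserves pushouts along maps in `M`. -/
def PreservesPushoutsOfMaps (P : E ⥤ E') : Prop :=
  ∀ {A B C : E} (f : A ⟶ C) (g : A ⟶ B), M f → PreservesColimit (span f g) P

/-- `M` is closed under Leibniz application of `η : 𝟭 E ⟶ F`: for `f : A ⟶ B` in `M`, the map
from the pushout `B +_A F A` to `F B` that is induced by `η_B` and `F f` is in `M`. -/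
def ClosedUnderLeibniz {F : E ⥤ E} (η : 𝟭 E ⟶ F) : Prop :=
  ∀ {A B Q : E} (f : A ⟶ B) (inl : B ⟶ Q) (inr : F.obj A ⟶ Q)
    (h : IsPushout f (η.app A) inl inr), M f →
      M (h.desc (η.app B) (F.map f) (η.naturality f))

end ClassesOfMaps

/-! ### Algebras of a pointed endofunctor -/

section Algebras

variable {E : Type u} [Category.{v} E] {F : E ⥤ E}

/-- The category of algebras of the pointed endofunctor `(F, η)`: objects `A` with a map
`a : F A ⟶ A` such that `a ∘ η_A = 𝟙`, and maps commuting with the structure maps. -/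
abbrev PtAlg (η : 𝟭 E ⟶ F) : Type (max u v) :=
  ObjectProperty.FullSubcategory
    (fun A : Endofunctor.Algebra F => η.app A.a ≫ A.str = 𝟙 A.a)

/-- The forgetful functor from algebras to the underlying category. -/
abbrev PtAlg.forget (η : 𝟭 E ⟶ F) : PtAlg η ⥤ E :=
  ObjectProperty.ι _ ⋙ Endofunctor.Algebra.forget F

/-- A functor to the category of algebras, from a functor to `E` with a natural structure map. -/
def PtAlg.lift {X : Type u₁} [Category.{v₁} X] (η : 𝟭 E ⟶ F) (K : X ⥤ E) (s : K ⋙ F ⟶ K)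
    (hs : ∀ A, η.app (K.obj A) ≫ s.app A = 𝟙 _) : X ⥤ PtAlg η where
  obj A := ⟨⟨K.obj A, s.app A⟩, hs A⟩
  map f := ObjectProperty.homMk ⟨K.map f, s.naturality f⟩

end Algebras

/-! ### Configurations -/

/-- A configuration for the free monad sequence on a pointed endofunctor. -/
structure ConfP (κ : Ordinal.{w}) : Type (max (u + 1) (v + 1)) where
  E : Type u
  [cat : Category.{v} E]
  M : MorphismProperty E
  F : E ⥤ E
  η : 𝟭 E ⟶ F
  hasCompositions : HasCompositions M κ
  hasPushouts : HasPushoutsOfMaps M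
  unit_mem : ∀ A, M (η.app A)
  leibniz : ClosedUnderLeibniz M η
  map_mem : ∀ {A B : E} (f : A ⟶ B), M f → M (F.map f)
  convergence : PreservesCompositions M κ F

namespace ConfP

attribute [instance] cat

variable {κ : Ordinal.{w}}

/-- A morphism of configurations: a functor `P` that preserves the classes of maps,
`κ`-compositions and pushouts, together with an isomorphism making it a (strong) map of pointed
endofunctors. -/
structure Hom (X Y : ConfP.{w, v, u} κ) : Type (max u v) where
  P : X.E ⥤ Y.E
  φ : P ⋙ Y.F ≅ X.F ⋙ P
  map_mem : ∀ {A B : X.E} (f : A ⟶ B), X.M f → Y.M (P.map f)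
  compositions : ∀ α : Ordinal.{w}, α ≤ κ → Order.IsSuccLimit α → PreservesCompositions X.M α P
  pushouts : PreservesPushoutsOfMaps X.M P
  unit : ∀ A, Y.η.app (P.obj A) ≫ φ.hom.app A = P.map (X.η.app A)

theorem Hom.ext' {X Y : ConfP.{w, v, u} κ} {f g : Hom X Y} (hP : f.P = g.P) (hφ : f.φ ≍ g.φ) :
    f = g := by
  cases f; cases g
  cases hP; cases hφ
  rfl

/-- A functor as in the definition of morphisms sends chains to chains. -/
theorem isMapChain_comp {E : Type u} [Category.{v} E] {E' : Type u₁} [Category.{v₁} E']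
    {M : MorphismProperty E} {M' : MorphismProperty E'} {P : E ⥤ E'}
    (hM : ∀ {A B : E} (f : A ⟶ B), M f → M' (P.map f))
    (hP : ∀ α : Ordinal.{w}, α ≤ κ → Order.IsSuccLimit α → PreservesCompositions M α P)
    {α : Ordinal.{w}} (hα : α ≤ κ) {D : Set.Iio α ⥤ E} (hD : IsMapChain M D) :
    IsMapChain M' (D ⋙ P) where
  continuous := ⟨fun m hm => by
    have := hD.continuous
    -- the ordinals below `m` as a principal segment of the ordinals below `α`
    let p : Set.Iio m.1 <i Set.Iio α :=
      ⟨⟨⟨fun i => ⟨i.1, lt_trans (Set.mem_Iio.1 i.2) (Set.mem_Iio.1 m.2)⟩,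
        fun i j h => Subtype.ext (congrArg (fun x : Set.Iio α => x.1) h)⟩, Iff.rfl⟩, m, fun b =>
        ⟨fun h => by obtain ⟨i, rfl⟩ := h; exact i.2, fun hb => ⟨⟨b.1, hb⟩, rfl⟩⟩⟩
    have hm' : Order.IsSuccLimit m.1 := by
      refine ⟨fun h => hm.1 (fun b _ => (h (zero_le (a := m.1))).trans (zero_le (a := b.1))),
        fun a ha => hm.2 ⟨a, ha.lt.trans m.2⟩ ⟨ha.lt, fun c h₁ h₂ => ha.2 h₁ h₂⟩⟩
    let r : Set.Iio m.1 ⥤ E := p.monotone.functor ⋙ D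
    have hr : IsMapChain M r := by
      refine ⟨?_, ?_⟩
      · exact inferInstanceAs ((p : Set.Iio m.1 ≤i Set.Iio α).monotone.functor ⋙
          D).IsWellOrderContinuous
      · intro i j h
        have h' : p i ⋖ p j :=
          ⟨h.lt, fun c h₁ h₂ => h.2 (c := ⟨c.1, lt_trans h₂ j.2⟩) h₁ h₂⟩
        exact hD.succ_mem h'
    have : PreservesColimit r P := hP _ (m.2.le.trans hα) hm' r hr
    have hc : IsColimit (P.mapCocone (p.cocone D)) :=
      isColimitOfPreserves P (D.isColimitOfIsWellOrderContinuous' p hm)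
    let e : Set.Iio m ≃o Set.Iio m.1 :=
      ⟨⟨fun i => ⟨i.1.1, i.2⟩, fun i => ⟨⟨i.1, lt_trans (Set.mem_Iio.1 i.2) (Set.mem_Iio.1 m.2)⟩,
        i.2⟩, fun _ => rfl, fun _ => rfl⟩, Iff.rfl⟩
    exact ⟨hc.whiskerEquivalence e.equivalence⟩⟩
  succ_mem h := hM _ (hD.succ_mem h)

/-- The identity morphism. -/
def Hom.id (X : ConfP.{w, v, u} κ) : Hom X X where
  P := 𝟭 _
  φ := NatIso.ofComponents (fun _ => Iso.refl _)
  map_mem _ h := h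
  compositions _ _ _ _ _ := inferInstance
  pushouts _ _ _ := inferInstance
  unit A := by simp

/-- Composition of morphisms. -/
def Hom.comp {X Y Z : ConfP.{w, v, u} κ} (f : Hom X Y) (g : Hom Y Z) : Hom X Z where
  P := f.P ⋙ g.P
  φ := NatIso.ofComponents (fun A => g.φ.app (f.P.obj A) ≪≫ g.P.mapIso (f.φ.app A))
    (fun {A B} m => by
      have h₁ := congrArg g.P.map (f.φ.hom.naturality m)
      have h₂ := g.φ.hom.naturality (f.P.map m)
      simp only [Functor.comp_map, Functor.map_comp] at h₁ h₂
      simp only [Functor.comp_map, Iso.trans_hom, Functor.mapIso_hom, Iso.app_hom, Category.assoc]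
      rw [← Category.assoc, h₂, Category.assoc, h₁])
  map_mem m h := g.map_mem _ (f.map_mem m h)
  compositions α hα hl D hD := by
    have := f.compositions α hα hl D hD
    have := g.compositions α hα hl _ (isMapChain_comp f.map_mem f.compositions hα hD)
    infer_instance
  pushouts a b h := by
    have := f.pushouts a b h
    have := g.pushouts (f.P.map a) (f.P.map b) (f.map_mem a h)
    have : PreservesColimit (span a b ⋙ f.P) g.P :=
      preservesColimit_of_iso_diagram g.P (spanCompIso f.P a b).symm
    infer_instance
  unit A := by
    have h₁ := congrArg g.P.map (f.unit A)
    have h₂ := g.unit (f.P.obj A)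
    simp only [Functor.map_comp, Functor.comp_obj] at h₁ h₂
    simp only [Functor.comp_obj, Functor.comp_map, NatIso.ofComponents_hom_app, Iso.trans_hom,
      Iso.app_hom, Functor.mapIso_hom]
    rw [← Category.assoc, h₂, h₁]

instance : Category (ConfP.{w, v, u} κ) where
  Hom := Hom
  id := Hom.id
  comp := Hom.comp
  id_comp f := Hom.ext' rfl (heq_of_eq (by ext A; simp [Hom.comp, Hom.id]))
  comp_id f := Hom.ext' rfl (heq_of_eq (by ext A; simp [Hom.comp, Hom.id]))
  assoc f g h := Hom.ext' rfl (heq_of_eq (by ext A; simp [Hom.comp]))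

/-- The structure map of the image of an algebra under a morphism of configurations:
`F₂ P A ≅ P F₁ A ⟶ P A`. -/
def Hom.algStr {X Y : ConfP.{w, v, u} κ} (f : Hom X Y) :
    (PtAlg.forget X.η ⋙ f.P) ⋙ Y.F ⟶ PtAlg.forget X.η ⋙ f.P where
  app A := f.φ.hom.app A.obj.a ≫ f.P.map A.obj.str
  naturality {A B} m := by
    have h₁ := f.φ.hom.naturality m.hom.f
    have h₂ := congrArg f.P.map m.hom.h
    simp only [Functor.map_comp] at h₂
    exact (Category.assoc _ _ _).symm.trans ((congrArg (· ≫ f.P.map B.obj.str) h₁).trans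
      ((Category.assoc _ _ _).trans ((congrArg (f.φ.hom.app A.obj.a ≫ ·) h₂).trans
        (Category.assoc _ _ _).symm)))

/-- The functor between categories of algebras induced by a morphism of configurations. -/
def Hom.algMap {X Y : ConfP.{w, v, u} κ} (f : Hom X Y) : PtAlg X.η ⥤ PtAlg Y.η :=
  PtAlg.lift Y.η (PtAlg.forget X.η ⋙ f.P) f.algStr (fun A =>
    (Category.assoc _ _ _).symm.trans ((congrArg (· ≫ f.P.map A.obj.str) (f.unit A.obj.a)).trans
      ((f.P.map_comp _ _).symm.trans ((congrArg f.P.map A.property).trans (f.P.map_id _)))))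

theorem algHom_ext {X Y : ConfP.{w, v, u} κ} {P : X.E ⥤ Y.E}
    {s t : (PtAlg.forget X.η ⋙ P) ⋙ Y.F ⟶ PtAlg.forget X.η ⋙ P} (h : s = t)
    {hs : ∀ A, Y.η.app ((PtAlg.forget X.η ⋙ P).obj A) ≫ s.app A = 𝟙 _}
    {ht : ∀ A, Y.η.app ((PtAlg.forget X.η ⋙ P).obj A) ≫ t.app A = 𝟙 _}
    {i : PtAlg.forget X.η ⋙ P ≅ PtAlg.lift Y.η _ s hs ⋙ PtAlg.forget Y.η}
    {j : PtAlg.forget X.η ⋙ P ≅ PtAlg.lift Y.η _ t ht ⋙ PtAlg.forget Y.η}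
    (hi : ∀ A, i.hom.app A = 𝟙 (P.obj A.obj.a)) (hj : ∀ A, j.hom.app A = 𝟙 (P.obj A.obj.a)) :
    FunS.Hom.mk (X := ⟨PtAlg X.η, X.E, PtAlg.forget X.η⟩)
      (Y := ⟨PtAlg Y.η, Y.E, PtAlg.forget Y.η⟩) (PtAlg.lift Y.η _ s hs) P i =
    FunS.Hom.mk (PtAlg.lift Y.η _ t ht) P j := by
  subst h
  exact FunS.Hom.ext' (fun A => (hi A).trans (hj A).symm)

/-- The functor sending a configuration `(E, M, F)` to the forgetful functor from the category of
`F`-algebras to `E`. -/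
def forgetAlg (κ : Ordinal.{w}) : ConfP.{w, v, u} κ ⥤ FunS.{v, v, max u v, u} where
  obj X := ⟨PtAlg X.η, X.E, PtAlg.forget X.η⟩
  map f := ⟨f.algMap, f.P, Iso.refl _⟩
  map_id X := algHom_ext (X := X) (Y := X) (P := 𝟭 _)
    (s := Hom.algStr (Hom.id X))
    (t := { app := fun A => A.obj.str, naturality := fun _ _ m => m.hom.h })
    (hs := fun A => ((Hom.id X).algMap.obj A).property) (ht := fun A => A.property)
    (by ext A; exact Category.id_comp _) (fun _ => rfl) (fun _ => rfl)
  map_comp {X Y Z} f g := algHom_ext (X := X) (Y := Z) (P := f.P ⋙ g.P)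
    (s := Hom.algStr (Hom.comp f g))
    (t := { app := fun A => (g.algMap.obj (f.algMap.obj A)).obj.str
            naturality := fun _ _ m => (g.algMap.map (f.algMap.map m)).hom.h })
    (hs := fun A => ((Hom.comp f g).algMap.obj A).property)
    (ht := fun A => (g.algMap.obj (f.algMap.obj A)).property)
    (by
      ext A
      exact (Category.assoc _ _ _).trans
        (congrArg (g.φ.hom.app (f.P.obj A.obj.a) ≫ ·) (g.P.map_comp _ _).symm))
    (fun _ => rfl)
    (fun A => (Category.comp_id _).trans (g.P.map_id _))

end ConfP

/-! Free algebras are built by a transfinite sequence of partial algebras: an object `A`, a part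
`dom` of `F A` containing the image of `η_A`, with `dom ⟶ F A` in `M`, and a structure map on `dom`.
The start is `A` with structure defined only on the image of the unit (`trivial`). One step
(`exists_isExtension`) pushes out `F A ← dom → A`, so that all of `F A` acts with values in the new
carrier; closure under Leibniz application puts the new inclusion in `M`. At limits one takes
colimits of carriers and of domains. At stage `κ` the domains and the objects `F A_i` interleave,
and since `F` preserves the colimit the inclusion becomes invertible (`isIso_incl`): the structure
map is total.

The universal property is proved at once for all morphisms of configurations `f : X ⟶ Y` out of `X`:
a map `P A ⟶ B` into an algebra of `Y` extends uniquely to a homomorphism on the image under `P` of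
each stage, because `P` preserves the pushouts and colimits that build the sequence
(`IsExtension.existsUnique`, `existsUnique_isHom_of_isColimit`). The case of the identity says that
the algebra is free; the general case says that `P` preserves free algebras.

By `AdjuS.exists_hom`, this preservation turns each square of forgetful functors into a morphism of
adjunctions. The restriction to right adjoints is faithful, so the chosen lifts are automatically
functorial. -/

/-! ### Colimits of chains that need not be continuous -/

section

variable {E : Type u} [Category.{v} E] (M : MorphismProperty E)

/-- The diagram `D` has a colimit that is also a colimit in the wide subcategory given by `M`. -/
def HasColimitIn {J : Type u₁} [Category.{v₁} J] (D : J ⥤ E) : Prop :=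
  ∃ (c : Cocone D) (hc : IsColimit c), (∀ i, M (c.ι.app i)) ∧
    ∀ s : Cocone D, (∀ i, M (s.ι.app i)) → M (hc.desc s)

variable {M}

theorem HasColimitIn.of_isTerminal {J : Type u₁} [Category.{v₁} J] {D : J ⥤ E} {t : J}
    (ht : IsTerminal t) (hD : ∀ {i j : J} (f : i ⟶ j), M (D.map f)) : HasColimitIn M D :=
  ⟨coconeOfDiagramTerminal ht D, colimitOfDiagramTerminal ht D, fun _ => hD _, fun _ hs => hs t⟩

/-- The inclusion of initial segments of ordinals. -/
abbrev iioInclusion {γ α : Ordinal.{w}} (h : γ ≤ α) : Set.Iio γ ⥤ Set.Iio α :=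
  Monotone.functor (f := fun i : Set.Iio γ => (⟨i.1, lt_of_lt_of_le i.2 h⟩ : Set.Iio α))
    (fun _ _ hij => hij)

/-- Colimits of the restrictions of a chain `D` to the nonempty initial segments
`{i | i < max 1 β}`. -/
structure SegmentColimits {α : Ordinal.{w}} (D : Set.Iio α ⥤ E) where
  obj : Set.Iio α → E
  -- The bound `max 1 β` keeps stage `0` nonempty, as `E` need not have an initial object. At limit
  -- stages it equals `β`.
  ι (β i : Set.Iio α) (h : i.1 < max 1 β.1) : D.obj i ⟶ obj β
  w (β : Set.Iio α) {i j : Set.Iio α} (f : i ⟶ j) (hi : i.1 < max 1 β.1) (hj : j.1 < max 1 β.1) :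
    D.map f ≫ ι β j hj = ι β i hi
  desc (β : Set.Iio α) {X : E} (s : ∀ i : Set.Iio α, i.1 < max 1 β.1 → (D.obj i ⟶ X))
    (hs : ∀ {i j : Set.Iio α} (f : i ⟶ j) hi hj, D.map f ≫ s j hj = s i hi) : obj β ⟶ X
  fac (β : Set.Iio α) {X : E} (s : ∀ i : Set.Iio α, i.1 < max 1 β.1 → (D.obj i ⟶ X))
    (hs : ∀ {i j : Set.Iio α} (f : i ⟶ j) hi hj, D.map f ≫ s j hj = s i hi) (i hi) :
    ι β i hi ≫ desc β s hs = s i hi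
  hom_ext {β : Set.Iio α} {X : E} {f g : obj β ⟶ X} (h : ∀ i hi, ι β i hi ≫ f = ι β i hi ≫ g) :
    f = g

/-! ### Replacing a chain by the continuous chain of its segment colimits -/

namespace SegmentColimits

variable {α : Ordinal.{w}} {D : Set.Iio α ⥤ E} (S : SegmentColimits D)

theorem w_assoc (β : Set.Iio α) {i j : Set.Iio α} (f : i ⟶ j) (hi : i.1 < max 1 β.1)
    (hj : j.1 < max 1 β.1) {Z : E} (z : S.obj β ⟶ Z) :
    D.map f ≫ S.ι β j hj ≫ z = S.ι β i hi ≫ z := by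
  rw [← Category.assoc, S.w]

/-- The maps between the colimits of initial segments. -/
def map {β γ : Set.Iio α} (h : β ≤ γ) : S.obj β ⟶ S.obj γ :=
  S.desc β (fun i hi => S.ι γ i (lt_of_lt_of_le hi (max_le_max le_rfl h)))
    (fun _ _ _ => S.w _ _ _ _)

theorem ι_map {β γ : Set.Iio α} (h : β ≤ γ) (i : Set.Iio α) (hi : i.1 < max 1 β.1) :
    S.ι β i hi ≫ S.map h = S.ι γ i (lt_of_lt_of_le hi (max_le_max le_rfl h)) :=
  S.fac β _ (fun _ _ _ => S.w _ _ _ _) i hi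

theorem ι_map_assoc {β γ : Set.Iio α} (h : β ≤ γ) (i : Set.Iio α) (hi : i.1 < max 1 β.1) {Z : E}
    (z : S.obj γ ⟶ Z) : S.ι β i hi ≫ S.map h ≫ z =
      S.ι γ i (lt_of_lt_of_le hi (max_le_max le_rfl h)) ≫ z := by
  rw [← Category.assoc, ι_map]

/-- The colimits of the initial segments of a chain form a chain. -/
@[simps]
def functor : Set.Iio α ⥤ E where
  obj := S.obj
  map f := S.map (leOfHom f)
  map_id β := S.hom_ext (fun i hi => by rw [ι_map, Category.comp_id])
  map_comp f g := S.hom_ext (fun i hi => by rw [ι_map, ι_map_assoc, ι_map])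

/-- A cocone on a chain induces a map out of the colimits of its initial segments. -/
def descCocone (s : Cocone D) (β : Set.Iio α) : S.obj β ⟶ s.pt :=
  S.desc β (fun i _ => s.ι.app i) (fun f _ _ => s.w f)

theorem ι_descCocone (s : Cocone D) (β i : Set.Iio α) (hi : i.1 < max 1 β.1) :
    S.ι β i hi ≫ S.descCocone s β = s.ι.app i :=
  S.fac β _ (fun f _ _ => s.w f) i hi

/-- The cocone on the chain of colimits of initial segments induced by a cocone. -/
@[simps]
def cocone (s : Cocone D) : Cocone S.functor where
  pt := s.pt
  ι := { app := S.descCocone s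
         naturality := fun β γ f => (S.hom_ext fun i hi => by
            rw [ι_map_assoc, ι_descCocone, ι_descCocone] :
            S.map (leOfHom f) ≫ S.descCocone s γ = S.descCocone s β).trans
              (Category.comp_id _).symm }

/-- Below a limit `m`, each index `i` already occurs in the segment at stage `succ i < m`. A cocone
on the stages below `m` thus gives a leg out of `D.obj i`, independent of the stage used (`key`),
and these legs induce the map out of stage `m`. -/
theorem isWellOrderContinuous (hα : Order.IsSuccLimit α) : S.functor.IsWellOrderContinuous := by
  refine ⟨fun m hm => ?_⟩
  have h0 : 0 < m.1 := by
    refine pos_iff_ne_zero.2 fun h => hm.1 fun b _ => ?_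
    change m.1 ≤ b.1
    rw [h]; exact zero_le
  have hσ {i : Set.Iio α} (hi : i < m) : Order.succ i.1 < m.1 := by
    refine lt_of_le_of_ne (Order.succ_le_of_lt hi) fun h => hm.2 i ⟨hi, fun c h₁ h₂ => ?_⟩
    have h₂' : c.1 < m.1 := h₂
    rw [← h] at h₂'
    exact absurd h₁ (not_lt.2 (Order.lt_succ_iff.1 h₂' : c.1 ≤ i.1))
  have hm1 : max 1 m.1 ≤ m.1 := max_le (Order.one_le_iff_pos.2 h0) le_rfl
  let σ (i : Set.Iio α) (hi : i < m) : Set.Iio m := ⟨⟨Order.succ i.1, hα.succ_lt i.2⟩, hσ hi⟩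
  have hi' {i : Set.Iio α} (h : i.1 < max 1 m.1) : i < m := (lt_of_lt_of_le h hm1 : i.1 < m.1)
  have hσ' (i : Set.Iio α) (hi : i < m) : i.1 < max 1 (σ i hi).1.1 :=
    lt_max_of_lt_right (Order.lt_succ i.1)
  have key (s : Cocone ((Set.principalSegIio m).monotone.functor ⋙ S.functor)) (β : Set.Iio m)
      (i : Set.Iio α) (hi : i < m) (h : i.1 < max 1 β.1.1) :
      S.ι β.1 i h ≫ s.ι.app β = S.ι (σ i hi).1 i (hσ' i hi) ≫ s.ι.app (σ i hi) := by
    have h' (γ δ : Set.Iio m) (hγ : i.1 < max 1 γ.1.1) (hδ : i.1 < max 1 δ.1.1) (hγδ : γ ≤ δ) :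
        S.ι γ.1 i hγ ≫ s.ι.app γ = S.ι δ.1 i hδ ≫ s.ι.app δ := by
      exact (congrArg (S.ι γ.1 i hγ ≫ ·) (s.w (homOfLE hγδ))).symm.trans
        (S.ι_map_assoc hγδ i hγ _)
    rcases le_total β (σ i hi) with h'' | h''
    · exact h' _ _ _ _ h''
    · exact (h' _ _ _ _ h'').symm
  let leg (s : Cocone ((Set.principalSegIio m).monotone.functor ⋙ S.functor)) (i : Set.Iio α)
      (h : i.1 < max 1 m.1) : D.obj i ⟶ s.pt :=
    S.ι (σ i (hi' h)).1 i (hσ' i (hi' h)) ≫ s.ι.app (σ i (hi' h))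
  have hleg (s : Cocone ((Set.principalSegIio m).monotone.functor ⋙ S.functor)) {i j : Set.Iio α}
      (f : i ⟶ j) (hi : i.1 < max 1 m.1) (hj : j.1 < max 1 m.1) :
      D.map f ≫ leg s j hj = leg s i hi :=
    (S.w_assoc _ f (lt_of_le_of_lt (leOfHom f : i.1 ≤ j.1) (hσ' j (hi' hj))) _ _).trans
      (key s _ i (hi' hi) _)
  refine ⟨{ desc := fun s => S.desc m (leg s) (hleg s), fac := fun s β => ?_,
            uniq := fun s f hf => ?_ }⟩
  · refine S.hom_ext (β := β.1) fun i hi => (S.ι_map_assoc β.2.le i hi _).trans ?_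
    have h : i.1 < max 1 m.1 := lt_of_lt_of_le hi (max_le_max le_rfl (β.2 : β.1 < m).le)
    exact (S.fac m (leg s) (hleg s) i h).trans (key s β i (hi' h) hi).symm
  · refine S.hom_ext (β := m) fun i hi => Eq.trans ?_ (S.fac m (leg s) (hleg s) i hi).symm
    exact ((S.ι_map_assoc (σ i (hi' hi)).2.le i (hσ' i (hi' hi)) f).symm.trans
      (congrArg (S.ι (σ i (hi' hi)).1 i (hσ' i (hi' hi)) ≫ ·) (hf (σ i (hi' hi)))))

/-- The coprojection of the chain into the chain of colimits of initial segments, shifted by one. -/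
def ιSucc (hα : Order.IsSuccLimit α) (i : Set.Iio α) :
    D.obj i ⟶ S.obj ⟨Order.succ i.1, hα.succ_lt i.2⟩ :=
  S.ι _ _ (lt_max_of_lt_right (Order.lt_succ i.1))

/-- Stages are linearly ordered, so the leg at `i` does not depend on the stage through which it is
taken; `succ i` serves as the standard choice. -/
theorem ι_comp_app (hα : Order.IsSuccLimit α) (c : Cocone S.functor) (β i : Set.Iio α)
    (h : i.1 < max 1 β.1) : S.ι β i h ≫ c.ι.app β = S.ιSucc hα i ≫ c.ι.app _ := by
  have h' (γ δ : Set.Iio α) (hγ : i.1 < max 1 γ.1) (hδ : i.1 < max 1 δ.1) (hγδ : γ ≤ δ) :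
      S.ι γ i hγ ≫ c.ι.app γ = S.ι δ i hδ ≫ c.ι.app δ := by
    exact (congrArg (S.ι γ i hγ ≫ ·) (c.w (homOfLE hγδ))).symm.trans (S.ι_map_assoc hγδ i hγ _)
  rcases le_total β ⟨Order.succ i.1, hα.succ_lt i.2⟩ with h'' | h''
  · exact h' _ _ _ _ h''
  · exact (h' _ _ _ _ h'').symm

/-- A cocone on the chain of colimits of initial segments induces a cocone on the chain. -/
@[simps]
def coconeOfCocone (hα : Order.IsSuccLimit α) (c : Cocone S.functor) : Cocone D where
  pt := c.pt
  ι := { app := fun i => S.ιSucc hα i ≫ c.ι.app _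
         naturality := fun i j f =>
          (S.w_assoc _ f (lt_max_of_lt_right (Order.lt_succ_iff.2 (leOfHom f : i.1 ≤ j.1))) _
            _).trans ((S.ι_comp_app hα c ⟨Order.succ j.1, hα.succ_lt j.2⟩ i _).trans
              (Category.comp_id _).symm) }

/-- The chain of colimits of initial segments has the same colimit as the original chain. -/
def isColimitCoconeOfCocone (hα : Order.IsSuccLimit α) {c : Cocone S.functor}
    (hc : IsColimit c) : IsColimit (S.coconeOfCocone hα c) where
  desc s := hc.desc (S.cocone s)
  fac _ i := (Category.assoc _ _ _).trans ((congrArg (S.ιSucc hα i ≫ ·) (hc.fac _ _)).trans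
    (S.ι_descCocone _ _ _ _))
  uniq s f hf := hc.hom_ext fun β => S.hom_ext fun i hi =>
    (((Category.assoc _ _ _).symm.trans (congrArg (· ≫ f) (S.ι_comp_app hα c β i hi))).trans
      (hf i)).trans ((congrArg (S.ι β i hi ≫ ·) (hc.fac (S.cocone s) β)).trans
        (S.ι_descCocone _ _ _ _)).symm

end SegmentColimits

/-- All chains of maps in `M`, continuous or not, have colimits in `M`. -/
theorem HasCompositions.hasColimitIn {κ : Ordinal.{w}} (h : HasCompositions M κ)
    (α : Ordinal.{w}) (h0 : 0 < α) (hα : α ≤ κ) (D : Set.Iio α ⥤ E)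
    (hD : ∀ {i j : Set.Iio α} (f : i ⟶ j), M (D.map f)) : HasColimitIn M D := by
  have := h.multiplicative
  induction α using WellFoundedLT.induction with
  | ind α ih =>
  rcases Ordinal.zero_or_succ_or_isSuccLimit α with rfl | ⟨δ, rfl⟩ | hl
  · exact (lt_irrefl _ h0).elim
  · exact HasColimitIn.of_isTerminal (t := ⟨δ, Order.lt_succ δ⟩)
      (IsTerminal.ofUniqueHom (fun i => homOfLE (Order.lt_succ_iff.1 i.2 : i.1 ≤ δ))
        (fun _ _ => Subsingleton.elim _ _)) hD
  -- At a limit `α`, induction gives the colimits of all proper segments. They form a continuous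
  -- chain, to which the hypothesis on `(E, M)` applies, with the same colimit as `D`.
  have h1 : 1 < α := by simpa using hl.succ_lt h0
  have hm : ∀ β : Set.Iio α, max 1 β.1 < α := fun β => max_lt h1 β.2
  have key (β : Set.Iio α) : HasColimitIn M (iioInclusion (hm β).le ⋙ D) :=
    ih _ (hm β) (lt_of_lt_of_le zero_lt_one (le_max_left _ _)) ((hm β).le.trans hα) _
      (fun f => hD _)
  choose c hc hcM hcd using key
  let S : SegmentColimits D :=
    { obj := fun β => (c β).pt
      ι := fun β i hi => (c β).ι.app ⟨i.1, hi⟩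
      w := fun β i j f hi hj => (c β).w
        (show (⟨i.1, hi⟩ : Set.Iio (max 1 β.1)) ⟶ ⟨j.1, hj⟩ from homOfLE (leOfHom f : i.1 ≤ j.1))
      desc := fun β X s hs => (hc β).desc
        ⟨X, { app := fun i => s _ i.2
              naturality := fun i j f =>
                (hs (homOfLE (leOfHom f : i.1 ≤ j.1)) _ _).trans (Category.comp_id _).symm }⟩
      fac := fun β X s hs i hi => (hc β).fac _ _
      hom_ext := fun {β X f g} h => (hc β).hom_ext fun i => h ⟨i.1, i.2.trans (hm β)⟩ i.2 }
  -- This uses the colimit property inside `M`: the comparison map is induced by a cocone with legs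
  -- in `M`.
  have hSM {β γ : Set.Iio α} (hβγ : β ≤ γ) : M (S.map hβγ) := hcd _ _ (fun _ => hcM _ _)
  obtain ⟨c', hc', hcM', hcd'⟩ := h.exists_colimit α hα hl S.functor
    ⟨S.isWellOrderContinuous hl, fun h => hSM h.le⟩
  exact ⟨S.coconeOfCocone hl c', S.isColimitCoconeOfCocone hl hc',
    fun i => M.comp_mem _ _ (hcM _ _) (hcM' _),
    fun s hs => hcd' _ fun β => hcd _ _ fun i => hs _⟩

end

/-! ### Partial algebras of a configuration -/

namespace ConfP

variable {κ : Ordinal.{w}}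

/-- A partial algebra: an object `A` with a structure map that is defined on a part `dom` of `F A`
containing the image of the unit, where `dom ⟶ F A` is in `M`. -/
structure PartialAlg (X : ConfP.{w, v, u} κ) where
  carrier : X.E
  dom : X.E
  unit : carrier ⟶ dom
  incl : dom ⟶ X.F.obj carrier
  str : dom ⟶ carrier
  incl_mem : X.M incl
  unit_incl : unit ≫ incl = X.η.app carrier
  unit_str : unit ≫ str = 𝟙 carrier

namespace PartialAlg

variable {X : ConfP.{w, v, u} κ}

theorem unit_incl_assoc (T : PartialAlg X) {Z : X.E} (z : X.F.obj T.carrier ⟶ Z) :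
    T.unit ≫ T.incl ≫ z = X.η.app T.carrier ≫ z := by
  rw [← Category.assoc, unit_incl]

theorem unit_str_assoc (T : PartialAlg X) {Z : X.E} (z : T.carrier ⟶ Z) :
    T.unit ≫ T.str ≫ z = z := by
  rw [← Category.assoc, unit_str, Category.id_comp]

/-- A morphism of partial algebras whose components are in `M`. -/
@[ext]
structure Hom (S T : PartialAlg X) where
  map : S.carrier ⟶ T.carrier
  domMap : S.dom ⟶ T.dom
  map_mem : X.M map
  domMap_mem : X.M domMap
  unit_comm : S.unit ≫ domMap = map ≫ T.unit
  incl_comm : S.incl ≫ X.F.map map = domMap ≫ T.incl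
  str_comm : S.str ≫ map = domMap ≫ T.str

theorem Hom.unit_comm_assoc {S T : PartialAlg X} (f : Hom S T) {Z : X.E} (z : T.dom ⟶ Z) :
    S.unit ≫ f.domMap ≫ z = f.map ≫ T.unit ≫ z := by
  rw [← Category.assoc, f.unit_comm, Category.assoc]

theorem Hom.incl_comm_assoc {S T : PartialAlg X} (f : Hom S T) {Z : X.E}
    (z : X.F.obj T.carrier ⟶ Z) :
    S.incl ≫ X.F.map f.map ≫ z = f.domMap ≫ T.incl ≫ z := by
  rw [← Category.assoc, f.incl_comm, Category.assoc]

theorem Hom.str_comm_assoc {S T : PartialAlg X} (f : Hom S T) {Z : X.E} (z : T.carrier ⟶ Z) :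
    S.str ≫ f.map ≫ z = f.domMap ≫ T.str ≫ z := by
  rw [← Category.assoc, f.str_comm, Category.assoc]

instance : Category (PartialAlg X) where
  Hom := Hom
  id T :=
    { map := 𝟙 _
      domMap := 𝟙 _
      map_mem := by have := X.hasCompositions.multiplicative; exact X.M.id_mem _
      domMap_mem := by have := X.hasCompositions.multiplicative; exact X.M.id_mem _
      unit_comm := by simp
      incl_comm := by simp
      str_comm := by simp }
  comp f g :=
    { map := f.map ≫ g.map
      domMap := f.domMap ≫ g.domMap
      map_mem := by
        have := X.hasCompositions.multiplicative; exact X.M.comp_mem _ _ f.map_mem g.map_mem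
      domMap_mem := by
        have := X.hasCompositions.multiplicative; exact X.M.comp_mem _ _ f.domMap_mem g.domMap_mem
      unit_comm := by rw [f.unit_comm_assoc, g.unit_comm, Category.assoc]
      incl_comm := by rw [X.F.map_comp, f.incl_comm_assoc, g.incl_comm, Category.assoc]
      str_comm := by rw [f.str_comm_assoc, g.str_comm, Category.assoc] }
  id_comp f := Hom.ext (Category.id_comp _) (Category.id_comp _)
  comp_id f := Hom.ext (Category.comp_id _) (Category.comp_id _)
  assoc f g h := Hom.ext (Category.assoc _ _ _) (Category.assoc _ _ _)

variable (X) in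
/-- The underlying object of a partial algebra. -/
@[simps]
def carrierFunctor : PartialAlg X ⥤ X.E where
  obj := carrier
  map f := f.map

variable (X) in
/-- The domain of the structure map of a partial algebra. -/
@[simps]
def domFunctor : PartialAlg X ⥤ X.E where
  obj := dom
  map f := f.domMap

@[ext]
theorem hom_ext {S T : PartialAlg X} {f g : S ⟶ T} (h₁ : f.map = g.map)
    (h₂ : f.domMap = g.domMap) : f = g :=
  Hom.ext h₁ h₂

@[simp]
theorem id_map (T : PartialAlg X) : Hom.map (𝟙 T) = 𝟙 T.carrier := rfl

@[simp]
theorem comp_map {R S T : PartialAlg X} (f : R ⟶ S) (g : S ⟶ T) :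
    Hom.map (f ≫ g) = f.map ≫ g.map := rfl

variable (X) in
/-- The inclusion of the domain of the structure map, as a natural transformation. -/
@[simps]
def inclNatTrans : domFunctor X ⟶ carrierFunctor X ⋙ X.F where
  app := incl
  naturality _ _ f := f.incl_comm.symm

variable (X) in
/-- The structure map, as a natural transformation. -/
@[simps]
def strNatTrans : domFunctor X ⟶ carrierFunctor X where
  app := str
  naturality _ _ f := f.str_comm.symm

variable (X) in
/-- The partial unit, as a natural transformation. -/
@[simps]
def unitNatTrans : carrierFunctor X ⟶ domFunctor X where
  app := unit
  naturality _ _ f := f.unit_comm.symm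

/-! #### Colimits of chains of partial algebras -/

/-- A chain of partial algebras has a colimit, computed on carriers and on domains. -/
theorem exists_isColimit {J : Type u₁} [Category.{v₁} J] [Nonempty J] (D : J ⥤ PartialAlg X)
    (h₁ : HasColimitIn X.M (D ⋙ carrierFunctor X)) (h₂ : HasColimitIn X.M (D ⋙ domFunctor X)) :
    ∃ (c : Cocone D), Nonempty (IsColimit c) ∧
      Nonempty (IsColimit ((carrierFunctor X).mapCocone c)) ∧
      Nonempty (IsColimit ((domFunctor X).mapCocone c)) := by
  have := X.hasCompositions.multiplicative
  obtain ⟨a, ha, haM, hadM⟩ := h₁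
  obtain ⟨b, hb, hbM, hbdM⟩ := h₂
  let cu : Cocone (D ⋙ carrierFunctor X) :=
    (Cocone.precompose (Functor.whiskerLeft D (unitNatTrans X))).obj b
  let ci : Cocone (D ⋙ domFunctor X) :=
    (Cocone.precompose (Functor.whiskerLeft D (inclNatTrans X))).obj (X.F.mapCocone a)
  let cs : Cocone (D ⋙ domFunctor X) :=
    (Cocone.precompose (Functor.whiskerLeft D (strNatTrans X))).obj a
  have fu (j : J) : a.ι.app j ≫ ha.desc cu = (D.obj j).unit ≫ b.ι.app j := ha.fac cu j
  have fi (j : J) : b.ι.app j ≫ hb.desc ci = (D.obj j).incl ≫ X.F.map (a.ι.app j) := hb.fac ci j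
  have fs (j : J) : b.ι.app j ≫ hb.desc cs = (D.obj j).str ≫ a.ι.app j := hb.fac cs j
  let T : PartialAlg X :=
    { carrier := a.pt
      dom := b.pt
      unit := ha.desc cu
      incl := hb.desc ci
      str := hb.desc cs
      -- `F` need not preserve this colimit: the inclusion is induced by a cocone into `F` of the
      -- colimit, whose legs are in `M` because `F` preserves `M`.
      incl_mem := hbdM _ fun j =>
        X.M.comp_mem _ _ (D.obj j).incl_mem (X.map_mem _ (haM j))
      unit_incl := ha.hom_ext fun j => by
        refine (Category.assoc _ _ _).symm.trans ((congrArg (· ≫ hb.desc ci) (fu j)).trans ?_)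
        refine (Category.assoc _ _ _).trans ((congrArg ((D.obj j).unit ≫ ·) (fi j)).trans ?_)
        exact ((D.obj j).unit_incl_assoc _).trans (X.η.naturality (a.ι.app j)).symm
      unit_str := ha.hom_ext fun j => by
        refine (Category.assoc _ _ _).symm.trans ((congrArg (· ≫ hb.desc cs) (fu j)).trans ?_)
        refine (Category.assoc _ _ _).trans ((congrArg ((D.obj j).unit ≫ ·) (fs j)).trans ?_)
        exact ((D.obj j).unit_str_assoc _).trans (Category.comp_id _).symm }
  let c : Cocone D :=
    { pt := T
      ι := { app := fun j =>
              { map := a.ι.app j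
                domMap := b.ι.app j
                map_mem := haM j
                domMap_mem := hbM j
                unit_comm := (fu j).symm
                incl_comm := (fi j).symm
                str_comm := (fs j).symm }
             naturality := fun i j f => hom_ext (a.ι.naturality f) (b.ι.naturality f) } }
  refine ⟨c, ⟨?_⟩, ⟨ha.ofIsoColimit (Cocone.ext (Iso.refl _) fun j => Category.comp_id _)⟩,
    ⟨hb.ofIsoColimit (Cocone.ext (Iso.refl _) fun j => Category.comp_id _)⟩⟩
  let sa (s : Cocone D) := (carrierFunctor X).mapCocone s
  let sb (s : Cocone D) := (domFunctor X).mapCocone s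
  have ga (s : Cocone D) (j : J) : a.ι.app j ≫ ha.desc (sa s) = (s.ι.app j).map := ha.fac (sa s) j
  have gb (s : Cocone D) (j : J) : b.ι.app j ≫ hb.desc (sb s) = (s.ι.app j).domMap :=
    hb.fac (sb s) j
  refine
    { desc := fun s =>
        { map := ha.desc (sa s)
          domMap := hb.desc (sb s)
          map_mem := hadM _ fun j => (s.ι.app j).map_mem
          domMap_mem := hbdM _ fun j => (s.ι.app j).domMap_mem
          unit_comm := ha.hom_ext fun j => ?_
          incl_comm := hb.hom_ext fun j => ?_
          str_comm := hb.hom_ext fun j => ?_ }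
      fac := fun s j => hom_ext (ga s j) (gb s j)
      uniq := fun s m hm => hom_ext
        (ha.hom_ext fun j => (congrArg Hom.map (hm j)).trans (ga s j).symm)
        (hb.hom_ext fun j => (congrArg Hom.domMap (hm j)).trans (gb s j).symm) }
  · refine ((reassoc_of% (fu j)) _).trans ((Category.assoc _ _ _).trans ?_)
    refine (congrArg ((D.obj j).unit ≫ ·) (gb s j)).trans ((s.ι.app j).unit_comm.trans ?_)
    exact ((reassoc_of% (ga s j)) _).symm
  · refine ((reassoc_of% (fi j)) _).trans ((Category.assoc _ _ _).trans ?_)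
    refine (congrArg ((D.obj j).incl ≫ ·) ((X.F.map_comp _ _).symm.trans
      (congrArg X.F.map (ga s j)))).trans ((s.ι.app j).incl_comm.trans ?_)
    exact ((reassoc_of% (gb s j)) _).symm
  · refine ((reassoc_of% (fs j)) _).trans ((Category.assoc _ _ _).trans ?_)
    refine (congrArg ((D.obj j).str ≫ ·) (ga s j)).trans ((s.ι.app j).str_comm.trans ?_)
    exact ((reassoc_of% (gb s j)) _).symm

theorem exists_isColimit_iio {α : Ordinal.{w}} (h0 : 0 < α) (hα : α ≤ κ)
    (D : Set.Iio α ⥤ PartialAlg X) :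
    ∃ (c : Cocone D), Nonempty (IsColimit c) ∧
      Nonempty (IsColimit ((carrierFunctor X).mapCocone c)) ∧
      Nonempty (IsColimit ((domFunctor X).mapCocone c)) :=
  have : Nonempty (Set.Iio α) := ⟨⟨0, h0⟩⟩
  exists_isColimit D
    (X.hasCompositions.hasColimitIn α h0 hα _ fun f => (D.map f).map_mem)
    (X.hasCompositions.hasColimitIn α h0 hα _ fun f => (D.map f).domMap_mem)

theorem hasColimitsOfShape_iio {α : Ordinal.{w}} (h0 : 0 < α) (hα : α ≤ κ) :
    HasColimitsOfShape (Set.Iio α) (PartialAlg X) where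
  has_colimit D :=
    have ⟨c, ⟨hc⟩, _⟩ := exists_isColimit_iio h0 hα D
    ⟨⟨⟨c, hc⟩⟩⟩

theorem preservesColimitsOfShape_carrierFunctor {α : Ordinal.{w}} (h0 : 0 < α) (hα : α ≤ κ) :
    PreservesColimitsOfShape (Set.Iio α) (carrierFunctor X) where
  preservesColimit {D} :=
    have ⟨_, ⟨hc⟩, ⟨h⟩, _⟩ := exists_isColimit_iio h0 hα D
    preservesColimit_of_preserves_colimit_cocone hc h

theorem preservesColimitsOfShape_domFunctor {α : Ordinal.{w}} (h0 : 0 < α) (hα : α ≤ κ) :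
    PreservesColimitsOfShape (Set.Iio α) (domFunctor X) where
  preservesColimit {D} :=
    have ⟨_, ⟨hc⟩, _, ⟨h⟩⟩ := exists_isColimit_iio h0 hα D
    preservesColimit_of_preserves_colimit_cocone hc h

/-- Proper initial segments of `Set.Iio κ` are sets of the form `Set.Iio α`. -/
def iioIioOrderIso (m : Set.Iio κ) : Set.Iio m ≃o Set.Iio m.1 where
  toFun i := ⟨i.1.1, i.2⟩
  invFun i := ⟨⟨i.1, lt_trans (Set.mem_Iio.1 i.2) (Set.mem_Iio.1 m.2)⟩, i.2⟩
  left_inv _ := rfl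
  right_inv _ := rfl
  map_rel_iff' := Iff.rfl

theorem pos_of_isSuccLimit {m : Set.Iio κ} (hm : Order.IsSuccLimit m) : 0 < m.1 := by
  refine pos_iff_ne_zero.2 fun h => hm.1 fun b _ => ?_
  change m.1 ≤ b.1
  rw [h]; exact zero_le

/-- Transfinite iteration asks for colimits of all diagrams of the given ordinal shapes, continuous
or not; this is the use of `HasCompositions.hasColimitIn`. -/
theorem hasIterationOfShape (h0 : 0 < κ) : HasIterationOfShape (Set.Iio κ) (PartialAlg X) where
  hasColimitsOfShape_of_isSuccLimit m hm :=
    have := hasColimitsOfShape_iio (X := X) (pos_of_isSuccLimit hm) (m.2 : m.1 < κ).le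
    hasColimitsOfShape_of_equivalence (iioIioOrderIso m).symm.equivalence
  hasColimitsOfShape := hasColimitsOfShape_iio h0 le_rfl

/-- Morphisms of configurations and `F` are only assumed to preserve colimits of continuous chains,
so continuity must descend to carriers and domains. -/
theorem isWellOrderContinuous_comp {D : Set.Iio κ ⥤ PartialAlg X} (hD : D.IsWellOrderContinuous) :
    (D ⋙ carrierFunctor X).IsWellOrderContinuous ∧ (D ⋙ domFunctor X).IsWellOrderContinuous := by
  constructor <;> refine ⟨fun m hm => ?_⟩
  · have := preservesColimitsOfShape_carrierFunctor (X := X) (pos_of_isSuccLimit hm)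
      (m.2 : m.1 < κ).le
    have := preservesColimitsOfShape_of_equiv (iioIioOrderIso m).symm.equivalence
      (carrierFunctor X)
    exact ⟨isColimitOfPreserves (carrierFunctor X) (D.isColimitOfIsWellOrderContinuous m hm)⟩
  · have := preservesColimitsOfShape_domFunctor (X := X) (pos_of_isSuccLimit hm)
      (m.2 : m.1 < κ).le
    have := preservesColimitsOfShape_of_equiv (iioIioOrderIso m).symm.equivalence
      (domFunctor X)
    exact ⟨isColimitOfPreserves (domFunctor X) (D.isColimitOfIsWellOrderContinuous m hm)⟩

/-! #### The one-step extension of a partial algebra -/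

/-- The partial algebra on `A` whose structure map is only defined on the image of the unit. -/
@[simps]
def trivial (X : ConfP.{w, v, u} κ) (A : X.E) : PartialAlg X where
  carrier := A
  dom := A
  unit := 𝟙 A
  incl := X.η.app A
  str := 𝟙 A
  incl_mem := X.unit_mem A
  unit_incl := Category.id_comp _
  unit_str := Category.id_comp _

/-- The morphism `f : S ⟶ T` freely extends the structure map of `S` to `F S`. -/
def IsExtension {S T : PartialAlg X} (f : S ⟶ T) : Prop :=
  ∃ (k : X.F.obj S.carrier ⟶ T.carrier) (l : X.F.obj S.carrier ⟶ T.dom),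
    IsPushout S.incl S.str k f.map ∧ IsPushout f.map (X.η.app S.carrier) T.unit l ∧
      S.incl ≫ l = f.domMap ∧ l ≫ T.str = k ∧ l ≫ T.incl = X.F.map f.map

/-- The new carrier is the pushout of `F S` and `S` over `S.dom`, with `x` in `M` as a pushout of
`S.incl`. The new domain is the pushout of `x` along `η`, so its inclusion into `F` of the new
carrier is the Leibniz application of `η` to `x`. -/
theorem exists_isExtension (S : PartialAlg X) :
    ∃ (T : PartialAlg X) (f : S ⟶ T), IsExtension f := by
  have := X.hasCompositions.multiplicative
  have := X.hasPushouts.stable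
  have := X.hasPushouts.hasPushout S.incl S.str S.incl_mem
  have hp := IsPushout.of_hasPushout S.incl S.str
  set x := pushout.inr S.incl S.str
  set k := pushout.inl S.incl S.str
  have hx : X.M x := MorphismProperty.of_isPushout hp.flip S.incl_mem
  have := X.hasPushouts.hasPushout x (X.η.app S.carrier) hx
  have hq := IsPushout.of_hasPushout x (X.η.app S.carrier)
  set n := pushout.inl x (X.η.app S.carrier)
  set l := pushout.inr x (X.η.app S.carrier)
  have hl : X.M l := MorphismProperty.of_isPushout hq.flip hx
  -- The new structure map is the identity on the new carrier and `k` on `F S`; this equation glues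
  -- the two.
  have hk : x ≫ 𝟙 _ = X.η.app S.carrier ≫ k := by
    rw [← S.unit_incl, Category.assoc, hp.w, S.unit_str_assoc, Category.comp_id]
  let T : PartialAlg X :=
    { carrier := _
      dom := _
      unit := n
      incl := hq.desc (X.η.app _) (X.F.map x) (X.η.naturality x)
      str := hq.desc (𝟙 _) k hk
      incl_mem := X.leibniz x n l hq hx
      unit_incl := hq.inl_desc _ _ _
      unit_str := hq.inl_desc _ _ _ }
  let f : S ⟶ T :=
    { map := x
      domMap := S.incl ≫ l
      map_mem := hx
      domMap_mem := X.M.comp_mem _ _ S.incl_mem hl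
      unit_comm := by
        rw [S.unit_incl_assoc]; exact hq.w.symm
      incl_comm := ((Category.assoc _ _ _).trans
        (congrArg (S.incl ≫ ·) (hq.inr_desc _ _ _))).symm
      str_comm := ((Category.assoc _ _ _).trans
        ((congrArg (S.incl ≫ ·) (hq.inr_desc _ _ hk)).trans hp.w)).symm }
  exact ⟨T, f, k, l, hp, hq, rfl, hq.inr_desc _ _ _, hq.inr_desc _ _ _⟩

/-- The free algebra sequence on `A`, as a chain of partial algebras. -/
theorem exists_freeSequence [OrderBot (Set.Iio κ)] [SuccOrder (Set.Iio κ)] [NoMaxOrder (Set.Iio κ)]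
    (A : X.E) :
    ∃ D : Set.Iio κ ⥤ PartialAlg X, Nonempty (D.obj ⊥ ≅ trivial X A) ∧ D.IsWellOrderContinuous ∧
      ∀ i, IsExtension (D.map (homOfLE (Order.le_succ i))) := by
  choose T f hf using exists_isExtension (X := X)
  let Φ : SmallObject.SuccStruct (PartialAlg X) := ⟨trivial X A, T, f⟩
  have h0 : 0 < κ := lt_of_le_of_lt zero_le (⊥ : Set.Iio κ).2
  have := hasIterationOfShape (X := X) h0
  refine ⟨Φ.iterationFunctor _, ⟨Φ.iterationFunctorObjBotIso _⟩, inferInstance, fun i => ?_⟩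
  have hi := Φ.prop_iterationFunctor_map_succ i (not_isMax i)
  have key {R S : PartialAlg X} (g : R ⟶ S) (hg : Φ.prop g) : IsExtension g := by
    obtain ⟨R⟩ := hg
    exact hf R
  exact key _ hi

end PartialAlg

end ConfP

/-! ### Morphisms from partial algebras to algebras -/

namespace ConfP

variable {κ : Ordinal.{w}} {X Y : ConfP.{w, v, u} κ}

namespace Hom

variable (f : Hom X Y)

theorem φ_inv_naturality_assoc {A B : X.E} (m : A ⟶ B) {Z : Y.E}
    (z : Y.F.obj (f.P.obj B) ⟶ Z) :
    f.P.map (X.F.map m) ≫ f.φ.inv.app B ≫ z = f.φ.inv.app A ≫ Y.F.map (f.P.map m) ≫ z :=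
  (Category.assoc _ _ _).symm.trans ((congrArg (· ≫ z) (f.φ.inv.naturality m)).trans
    (Category.assoc _ _ _))

theorem φ_hom_inv_assoc (A : X.E) {Z : Y.E} (z : Y.F.obj (f.P.obj A) ⟶ Z) :
    f.φ.hom.app A ≫ f.φ.inv.app A ≫ z = z :=
  f.φ.hom_inv_id_app_assoc A z

theorem φ_inv_hom_assoc (A : X.E) {Z : Y.E} (z : f.P.obj (X.F.obj A) ⟶ Z) :
    f.φ.inv.app A ≫ f.φ.hom.app A ≫ z = z :=
  f.φ.inv_hom_id_app_assoc A z

theorem unit_inv_assoc (A : X.E) {Z : Y.E} (z : Y.F.obj (f.P.obj A) ⟶ Z) :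
    f.P.map (X.η.app A) ≫ f.φ.inv.app A ≫ z = Y.η.app (f.P.obj A) ≫ z := by
  rw [← f.unit A, Category.assoc, φ_hom_inv_assoc]

end Hom

namespace PartialAlg

/-- By the unit law of `B`, the homomorphism condition is automatic on the image of the unit. -/
theorem unit_map_str (B : PtAlg Y.η) {Z : Y.E} (h : Z ⟶ B.obj.a) :
    Y.η.app Z ≫ Y.F.map h ≫ B.obj.str = h :=
  (Category.assoc _ _ _).symm.trans ((congrArg (· ≫ B.obj.str) (Y.η.naturality h).symm).trans
    ((Category.assoc _ _ _).trans ((congrArg (h ≫ ·) B.property).trans (Category.comp_id h))))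

variable (f : ConfP.Hom X Y) (B : PtAlg Y.η)

/-- The map `h` from the image of a partial algebra to an algebra commutes with the structure maps
wherever they are defined. -/
def IsHom (T : PartialAlg X) (h : f.P.obj T.carrier ⟶ B.obj.a) : Prop :=
  f.P.map T.str ≫ h = f.P.map T.incl ≫ f.φ.inv.app T.carrier ≫ Y.F.map h ≫ B.obj.str

variable {f B}

theorem isHom_trivial (A : X.E) (h : f.P.obj A ⟶ B.obj.a) : IsHom f B (trivial X A) h := by
  refine Eq.trans (b := h) ?_ ?_
  · exact (congrArg (· ≫ h) (f.P.map_id A)).trans (Category.id_comp h)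
  · exact ((f.unit_inv_assoc A _).trans (unit_map_str B h)).symm

theorem IsHom.comp {S T : PartialAlg X} (g : S ⟶ T) {h : f.P.obj T.carrier ⟶ B.obj.a}
    (hh : IsHom f B T h) : IsHom f B S (f.P.map g.map ≫ h) := by
  rw [IsHom, ← f.P.map_comp_assoc, g.str_comm, f.P.map_comp_assoc, hh, ← f.P.map_comp_assoc,
    ← g.incl_comm, f.P.map_comp_assoc, f.φ_inv_naturality_assoc, Y.F.map_comp_assoc]

/-- The condition is an equation between maps out of `P T.dom`, so it can be tested on a jointly
epimorphic family; colimit coprojections provide one. -/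
theorem IsHom.of_comp {ι : Type*} {S : ι → PartialAlg X} {T : PartialAlg X} (g : ∀ i, S i ⟶ T)
    (hg : ∀ {Z : Y.E} {a b : f.P.obj T.dom ⟶ Z},
      (∀ i, f.P.map (g i).domMap ≫ a = f.P.map (g i).domMap ≫ b) → a = b)
    {h : f.P.obj T.carrier ⟶ B.obj.a} (hh : ∀ i, IsHom f B (S i) (f.P.map (g i).map ≫ h)) :
    IsHom f B T h :=
  hg fun i => by
    rw [← f.P.map_comp_assoc, ← (g i).str_comm, f.P.map_comp_assoc, hh, ← f.P.map_comp_assoc,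
      ← (g i).incl_comm, f.P.map_comp_assoc, f.φ_inv_naturality_assoc, ← Y.F.map_comp_assoc]

theorem isPushout_map {A C D Q : X.E} {a : A ⟶ C} {b : A ⟶ D} {p : C ⟶ Q} {q : D ⟶ Q}
    (h : IsPushout a b p q) (ha : X.M a) :
    IsPushout (f.P.map a) (f.P.map b) (f.P.map p) (f.P.map q) := by
  have := f.pushouts a b ha
  exact h.map f.P

/-- Homomorphisms to algebras extend uniquely along extensions of partial algebras. -/
theorem IsExtension.existsUnique {S T : PartialAlg X} {g : S ⟶ T} (hg : IsExtension g)
    {h : f.P.obj S.carrier ⟶ B.obj.a} (hh : IsHom f B S h) :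
    ∃! h' : f.P.obj T.carrier ⟶ B.obj.a, IsHom f B T h' ∧ f.P.map g.map ≫ h' = h := by
  obtain ⟨k, l, hp, hq, hd, hs, hi⟩ := hg
  have hp' := isPushout_map (f := f) hp S.incl_mem
  have hq' := isPushout_map (f := f) hq g.map_mem
  -- An extension must restrict along `k = l ≫ T.str` to the action of `B` on `F h`. That this
  -- agrees with `h` on `S.dom` is exactly the hypothesis on `h`.
  have w : f.P.map S.incl ≫ (f.φ.inv.app S.carrier ≫ Y.F.map h ≫ B.obj.str) =
      f.P.map S.str ≫ h := hh.symm
  have e₁ : f.P.map k ≫ hp'.desc _ _ w = f.φ.inv.app S.carrier ≫ Y.F.map h ≫ B.obj.str :=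
    hp'.inl_desc _ _ w
  have e₂ : f.P.map g.map ≫ hp'.desc _ _ w = h := hp'.inr_desc _ _ w
  refine ⟨hp'.desc _ _ w, ⟨hq'.hom_ext ?_ ?_, e₂⟩, ?_⟩
  -- The domain of `T` is a pushout: on the carrier part the condition follows from the unit laws,
  -- on the part `F S` from the choice of the map along `k`.
  · rw [← f.P.map_comp_assoc, T.unit_str, f.P.map_id, Category.id_comp, ← f.P.map_comp_assoc,
      T.unit_incl, f.unit_inv_assoc, unit_map_str]
  · rw [← f.P.map_comp_assoc, hs, e₁, ← f.P.map_comp_assoc, hi, f.φ_inv_naturality_assoc,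
      ← Y.F.map_comp_assoc, e₂]
  · rintro h' ⟨hh', e⟩
    refine hp'.hom_ext ?_ (e.trans e₂.symm)
    rw [e₁, ← hs, f.P.map_comp_assoc, hh', ← f.P.map_comp_assoc, hi, f.φ_inv_naturality_assoc,
      ← Y.F.map_comp_assoc, e]

/-! ### Extending homomorphisms along the free algebra sequence -/

theorem isMapChain_carrier {D : Set.Iio κ ⥤ PartialAlg X} (hD : D.IsWellOrderContinuous) :
    IsMapChain X.M (D ⋙ carrierFunctor X) :=
  ⟨(isWellOrderContinuous_comp hD).1, fun _ => (D.map _).map_mem⟩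

theorem isMapChain_dom {D : Set.Iio κ ⥤ PartialAlg X} (hD : D.IsWellOrderContinuous) :
    IsMapChain X.M (D ⋙ domFunctor X) :=
  ⟨(isWellOrderContinuous_comp hD).2, fun _ => (D.map _).domMap_mem⟩

/-- Compatible homomorphisms on the objects below a limit object extend to the limit object. -/
theorem existsUnique_isHom_of_isSuccLimit {D : Set.Iio κ ⥤ PartialAlg X}
    (hD : D.IsWellOrderContinuous) {j : Set.Iio κ} (hj : Order.IsSuccLimit j)
    (h : ∀ i : Set.Iio κ, i < j → (f.P.obj (D.obj i).carrier ⟶ B.obj.a))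
    (hh : ∀ i hi, IsHom f B (D.obj i) (h i hi))
    (hcomp : ∀ {i i' : Set.Iio κ} (m : i ⟶ i') (hi : i < j) (hi' : i' < j),
      f.P.map (D.map m).map ≫ h i' hi' = h i hi) :
    ∃! h' : f.P.obj (D.obj j).carrier ⟶ B.obj.a, IsHom f B (D.obj j) h' ∧
      ∀ (i : Set.Iio κ) (hi : i < j), f.P.map (D.map (homOfLE hi.le)).map ≫ h' = h i hi := by
  have c₁ := (isMapChain_comp f.map_mem f.compositions le_rfl (isMapChain_carrier hD)).continuous
  have c₂ := (isMapChain_comp f.map_mem f.compositions le_rfl (isMapChain_dom hD)).continuous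
  have q₁ := ((D ⋙ carrierFunctor X) ⋙ f.P).isColimitOfIsWellOrderContinuous j hj
  have q₂ := ((D ⋙ domFunctor X) ⋙ f.P).isColimitOfIsWellOrderContinuous j hj
  let s : Cocone ((Set.principalSegIio j).monotone.functor ⋙ (D ⋙ carrierFunctor X) ⋙ f.P) :=
    { pt := B.obj.a
      ι := { app := fun i => h i.1 i.2
             naturality := fun i i' m =>
              (hcomp (homOfLE (leOfHom m)) _ _).trans (Category.comp_id _).symm } }
  have e (i : Set.Iio κ) (hi : i < j) :
      f.P.map (D.map (homOfLE hi.le)).map ≫ q₁.desc s = h i hi :=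
    q₁.fac s ⟨i, hi⟩
  refine ⟨q₁.desc s, ⟨IsHom.of_comp (ι := Set.Iio j) (fun i => D.map (homOfLE (le_of_lt i.2)))
    (fun hab => q₂.hom_ext hab) (fun i => ?_), e⟩,
      fun k hk => q₁.hom_ext fun i => (hk.2 i.1 i.2).trans (e i.1 i.2).symm⟩
  exact (congrArg (IsHom f B (D.obj i.1)) (e i.1 i.2)).mpr (hh i.1 i.2)

section

variable [OrderBot (Set.Iio κ)] [SuccOrder (Set.Iio κ)] {D : Set.Iio κ ⥤ PartialAlg X}

/-- Homomorphisms to algebras extend uniquely along the free algebra sequence. -/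
theorem existsUnique_isHom_of_isWellOrderContinuous (hD : D.IsWellOrderContinuous)
    (hext : ∀ i, IsExtension (D.map (homOfLE (Order.le_succ i))))
    {h₀ : f.P.obj (D.obj ⊥).carrier ⟶ B.obj.a} (hh₀ : IsHom f B (D.obj ⊥) h₀) (j : Set.Iio κ) :
    ∃! h : f.P.obj (D.obj j).carrier ⟶ B.obj.a, IsHom f B (D.obj j) h ∧
      f.P.map (D.map (homOfLE (bot_le : ⊥ ≤ j))).map ≫ h = h₀ := by
  have hmap {a b c : Set.Iio κ} (m : a ⟶ b) (n : b ⟶ c) (m' : a ⟶ c) {Z : Y.E}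
      (z : f.P.obj (D.obj c).carrier ⟶ Z) :
      f.P.map (D.map m').map ≫ z = f.P.map (D.map m).map ≫ f.P.map (D.map n).map ≫ z := by
    rw [Subsingleton.elim m' (m ≫ n), D.map_comp, comp_map, f.P.map_comp_assoc]
  induction j using SuccOrder.limitRecOn with
  | isMin j hj =>
    obtain rfl := hj.eq_bot
    have hid (h : f.P.obj (D.obj ⊥).carrier ⟶ B.obj.a) :
        f.P.map (D.map (homOfLE (bot_le : (⊥ : Set.Iio κ) ≤ ⊥))).map ≫ h = h := by
      rw [Subsingleton.elim (homOfLE _) (𝟙 (⊥ : Set.Iio κ)), D.map_id, id_map, f.P.map_id,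
        Category.id_comp]
    exact ⟨h₀, ⟨hh₀, hid h₀⟩, fun h hh => (hid h).symm.trans hh.2⟩
  | succ j _ ih =>
    obtain ⟨h, ⟨hh, e⟩, hu⟩ := ih
    obtain ⟨h', ⟨hh', e'⟩, hu'⟩ := (hext j).existsUnique hh
    refine ⟨h', ⟨hh', ?_⟩, fun k hk => hu' k ⟨hk.1, hu _ ⟨hk.1.comp _, ?_⟩⟩⟩
    · rw [hmap (homOfLE bot_le) (homOfLE (Order.le_succ j)), e', e]
    · rw [← hmap _ _ (homOfLE bot_le), hk.2]
  | isSuccLimit j hj ih =>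
    choose h hh hu using ih
    -- Uniqueness at the earlier stages makes the extensions compatible, so they form a cocone.
    obtain ⟨h', ⟨hh', e⟩, hu'⟩ := existsUnique_isHom_of_isSuccLimit hD hj h
      (fun i hi => (hh i hi).1)
      (fun {i i'} m hi hi' => hu i hi _ ⟨(hh i' hi').1.comp _, by
        rw [← hmap _ _ (homOfLE bot_le), (hh i' hi').2]⟩)
    have hbot : ⊥ < j := hj.bot_lt
    refine ⟨h', ⟨hh', ?_⟩, fun k hk => ?_⟩
    · rw [hmap (𝟙 _) (homOfLE hbot.le), e ⊥ hbot, ← (hh ⊥ hbot).2]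
      simp
    · exact hu' k ⟨hk.1, fun i hi => hu i hi _ ⟨hk.1.comp _, by
        rw [← hmap _ _ (homOfLE bot_le), hk.2]⟩⟩

end

end PartialAlg

end ConfP

/-! ### Free algebras -/

namespace ConfP

variable {κ : Ordinal.{w}} {X Y : ConfP.{w, v, u} κ}

namespace PartialAlg

section

variable [SuccOrder (Set.Iio κ)] {D : Set.Iio κ ⥤ PartialAlg X}

/-- Homomorphisms to algebras extend uniquely to the colimit of the free algebra sequence. -/
theorem existsUnique_isHom_of_isColimit [OrderBot (Set.Iio κ)] (hκ : Order.IsSuccLimit κ)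
    {f : ConfP.Hom X Y} {B : PtAlg Y.η} (hD : D.IsWellOrderContinuous)
    (hext : ∀ i, IsExtension (D.map (homOfLE (Order.le_succ i))))
    {c : Cocone D} (hc : IsColimit ((carrierFunctor X).mapCocone c))
    (hc' : IsColimit ((domFunctor X).mapCocone c))
    {h₀ : f.P.obj (D.obj ⊥).carrier ⟶ B.obj.a} (hh₀ : IsHom f B (D.obj ⊥) h₀) :
    ∃! h : f.P.obj c.pt.carrier ⟶ B.obj.a, IsHom f B c.pt h ∧
      f.P.map (c.ι.app ⊥).map ≫ h = h₀ := by
  have := f.compositions κ le_rfl hκ _ (isMapChain_carrier hD)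
  have := f.compositions κ le_rfl hκ _ (isMapChain_dom hD)
  have q₁ := isColimitOfPreserves f.P hc
  have q₂ := isColimitOfPreserves f.P hc'
  have hmap {a b : Set.Iio κ} (m : a ⟶ b) {Z : Y.E} (z : f.P.obj c.pt.carrier ⟶ Z) :
      f.P.map (c.ι.app a).map ≫ z = f.P.map (D.map m).map ≫ f.P.map (c.ι.app b).map ≫ z := by
    rw [← c.w m, comp_map, f.P.map_comp_assoc]
  have hmap' {a b d : Set.Iio κ} (m : a ⟶ b) (n : b ⟶ d) (m' : a ⟶ d) {Z : Y.E}
      (z : f.P.obj (D.obj d).carrier ⟶ Z) :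
      f.P.map (D.map m').map ≫ z = f.P.map (D.map m).map ≫ f.P.map (D.map n).map ≫ z := by
    rw [Subsingleton.elim m' (m ≫ n), D.map_comp, comp_map, f.P.map_comp_assoc]
  choose h hh hu using existsUnique_isHom_of_isWellOrderContinuous (f := f) (B := B) hD hext hh₀
  have hcomp {i j : Set.Iio κ} (m : i ⟶ j) : f.P.map (D.map m).map ≫ h j = h i :=
    hu i _ ⟨(hh j).1.comp _, by rw [← hmap' _ _ (homOfLE bot_le), (hh j).2]⟩
  let s : Cocone ((D ⋙ carrierFunctor X) ⋙ f.P) :=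
    { pt := B.obj.a
      ι := { app := h
             naturality := fun i j m => (hcomp m).trans (Category.comp_id _).symm } }
  have e (i : Set.Iio κ) : f.P.map (c.ι.app i).map ≫ q₁.desc s = h i := q₁.fac s i
  have hbot : h ⊥ = h₀ := (hu ⊥ h₀ ⟨hh₀, by
    rw [Subsingleton.elim (homOfLE _) (𝟙 (⊥ : Set.Iio κ)), D.map_id, id_map, f.P.map_id,
      Category.id_comp]⟩).symm
  refine ⟨q₁.desc s, ⟨IsHom.of_comp (fun i => c.ι.app i) (fun hab => q₂.hom_ext hab)
    (fun i => ?_), (e ⊥).trans hbot⟩, fun k hk => q₁.hom_ext fun i => Eq.trans ?_ (e i).symm⟩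
  · exact (congrArg (IsHom f B (D.obj i)) (e i)).mpr (hh i).1
  · exact hu i _ ⟨hk.1.comp _, (hmap _ _).symm.trans hk.2⟩

/-- The colimit of the free algebra sequence is a total algebra. -/
theorem isIso_incl (hD : D.IsWellOrderContinuous)
    (hext : ∀ i, IsExtension (D.map (homOfLE (Order.le_succ i))))
    {c : Cocone D} (hc : IsColimit ((carrierFunctor X).mapCocone c))
    (hc' : IsColimit ((domFunctor X).mapCocone c)) : IsIso c.pt.incl := by
  have := X.convergence _ (isMapChain_carrier hD)
  have q := isColimitOfPreserves X.F hc
  choose k l _ _ hd _ hi using hext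
  have hw {i j : Set.Iio κ} (m : i ⟶ j) :
      (D.map m).domMap ≫ (c.ι.app j).domMap = (c.ι.app i).domMap :=
    congrArg Hom.domMap (c.w m)
  have hw' {i j : Set.Iio κ} (m : i ⟶ j) :
      (D.map m).map ≫ (c.ι.app j).map = (c.ι.app i).map :=
    congrArg Hom.map (c.w m)
  -- The maps `dom_i ⟶ F A_i ⟶ dom_{i+1}`, given by `incl` and `l`, interleave the two chains; the
  -- inverse of the colimit inclusion is induced by the maps `l i`.
  have hl (i : Set.Iio κ) : (D.obj i).incl ≫ l i ≫ (c.ι.app (Order.succ i)).domMap =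
      (c.ι.app i).domMap := by
    rw [← Category.assoc, hd, hw]
  have hcomp {i j : Set.Iio κ} (m : i ⟶ j) : X.F.map (D.map m).map ≫
      l j ≫ (c.ι.app (Order.succ j)).domMap = l i ≫ (c.ι.app (Order.succ i)).domMap := by
    rcases (leOfHom m).eq_or_lt with rfl | hij
    · rw [Subsingleton.elim m (𝟙 i), D.map_id, id_map, X.F.map_id, Category.id_comp]
    -- For `i < j` the map factors through `succ i`, where `F` of the step map is `l i` followed by
    -- the inclusion.
    · rw [Subsingleton.elim m (homOfLE (Order.le_succ i) ≫ homOfLE (Order.succ_le_of_lt hij)),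
        D.map_comp, comp_map, X.F.map_comp, ← hi, Category.assoc, Category.assoc,
        Hom.incl_comm_assoc, hl, hw]
  let s : Cocone ((D ⋙ carrierFunctor X) ⋙ X.F) :=
    { pt := c.pt.dom
      ι := { app := fun i => l i ≫ (c.ι.app (Order.succ i)).domMap
             naturality := fun i j m => (hcomp m).trans (Category.comp_id _).symm } }
  obtain ⟨t, e⟩ : ∃ t : X.F.obj c.pt.carrier ⟶ c.pt.dom, ∀ i, X.F.map (c.ι.app i).map ≫ t =
      l i ≫ (c.ι.app (Order.succ i)).domMap := ⟨q.desc s, fun i => q.fac s i⟩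
  refine ⟨t, hc'.hom_ext fun i => ?_, q.hom_ext fun i => ?_⟩
  · change (c.ι.app i).domMap ≫ c.pt.incl ≫ t = (c.ι.app i).domMap ≫ 𝟙 _
    exact ((Hom.incl_comm_assoc _ _).symm.trans (congrArg (_ ≫ ·) (e i))).trans
      ((hl i).trans (Category.comp_id _).symm)
  · change X.F.map (c.ι.app i).map ≫ t ≫ c.pt.incl = X.F.map (c.ι.app i).map ≫ 𝟙 _
    have : (l i ≫ (c.ι.app (Order.succ i)).domMap) ≫ c.pt.incl = X.F.map (c.ι.app i).map := by
      refine (Category.assoc _ _ _).trans ((congrArg (l i ≫ ·) (Hom.incl_comm _).symm).trans ?_)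
      refine (Category.assoc _ _ _).symm.trans ((congrArg (· ≫ _) (hi i)).trans ?_)
      exact (X.F.map_comp _ _).symm.trans (congrArg X.F.map (hw' _))
    exact (Category.assoc _ _ _).symm.trans ((congrArg (· ≫ c.pt.incl) (e i)).trans
      (this.trans (Category.comp_id _).symm))

end

/-- A partial algebra whose structure map is defined everywhere, as an algebra. -/
@[simps]
noncomputable def toPtAlg (T : PartialAlg X) [IsIso T.incl] : PtAlg X.η where
  obj := ⟨T.carrier, inv T.incl ≫ T.str⟩
  property := by rw [← T.unit_incl, Category.assoc, IsIso.hom_inv_id_assoc, T.unit_str]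

theorem map_iso_hom_comp (f : ConfP.Hom X Y) {S T : PartialAlg X} (e : S ≅ T) {Z : Y.E}
    (z : f.P.obj S.carrier ⟶ Z) : f.P.map e.hom.map ≫ f.P.map e.inv.map ≫ z = z := by
  rw [← f.P.map_comp_assoc, ← comp_map, e.hom_inv_id, id_map, f.P.map_id, Category.id_comp]

/-- Once `incl` is invertible, moving it and `φ` across the equation turns the partial condition
into the usual one. -/
theorem isHom_iff {f : ConfP.Hom X Y} {B : PtAlg Y.η} {T : PartialAlg X} [IsIso T.incl]
    {h : f.P.obj T.carrier ⟶ B.obj.a} :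
    IsHom f B T h ↔ Y.F.map h ≫ B.obj.str = (f.algMap.obj T.toPtAlg).obj.str ≫ h := by
  have e : (f.algMap.obj T.toPtAlg).obj.str ≫ h =
      f.φ.hom.app T.carrier ≫ f.P.map (inv T.incl) ≫ f.P.map T.str ≫ h :=
    (Category.assoc _ _ _).trans (congrArg (f.φ.hom.app T.carrier ≫ ·) (f.P.map_comp_assoc _ _ h))
  rw [IsHom]
  constructor
  · intro hh
    refine Eq.trans ?_ e.symm
    rw [hh, ← f.P.map_comp_assoc, IsIso.inv_hom_id, f.P.map_id, Category.id_comp,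
      f.φ_hom_inv_assoc]
  · intro hh
    have hh' := hh.trans e
    rw [hh', f.φ_inv_hom_assoc, ← f.P.map_comp_assoc, IsIso.hom_inv_id, f.P.map_id,
      Category.id_comp]

end PartialAlg

open PartialAlg in
/-- Free algebras exist, and morphisms of configurations preserve their universal property. -/
theorem exists_freeAlgebra (hκ : Order.IsSuccLimit κ) (X : ConfP.{w, v, u} κ) (A : X.E) :
    ∃ (L : PtAlg X.η) (ι : A ⟶ L.obj.a), ∀ (Y : ConfP.{w, v, u} κ) (f : ConfP.Hom X Y)
      (B : PtAlg Y.η) (h : f.P.obj A ⟶ B.obj.a),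
      ∃! m : f.algMap.obj L ⟶ B, f.P.map ι ≫ m.hom.f = h := by
  have h0 : 0 < κ := hκ.bot_lt
  let _ : OrderBot (Set.Iio κ) := { bot := ⟨0, h0⟩, bot_le := fun a => (zero_le : 0 ≤ a.1) }
  let _ : SuccOrder (Set.Iio κ) := SuccOrder.ofLinearWellFoundedLT _
  have : NoMaxOrder (Set.Iio κ) :=
    ⟨fun a => ⟨⟨Order.succ a.1, hκ.succ_lt a.2⟩, (Order.lt_succ a.1 : a.1 < _)⟩⟩
  obtain ⟨D, ⟨e⟩, hD, hext⟩ := exists_freeSequence (X := X) A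
  obtain ⟨c, -, ⟨hc⟩, ⟨hc'⟩⟩ := exists_isColimit_iio h0 le_rfl D
  have := isIso_incl hD hext hc hc'
  refine ⟨c.pt.toPtAlg, e.inv.map ≫ (c.ι.app ⊥).map, fun Y f B h => ?_⟩
  have hh := (isHom_trivial (f := f) (B := B) A h).comp e.hom
  obtain ⟨k, ⟨hk, hk'⟩, hu⟩ := existsUnique_isHom_of_isColimit hκ hD hext hc hc' hh
  refine ⟨ObjectProperty.homMk ⟨k, isHom_iff.1 hk⟩, ?_, fun m hm => ?_⟩
  · exact (f.P.map_comp_assoc _ _ _).trans ((congrArg (f.P.map e.inv.map ≫ ·) hk').trans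
      (map_iso_hom_comp f e.symm h))
  · have : m.hom.f = k := hu _ ⟨isHom_iff.2 m.hom.h,
      (map_iso_hom_comp f e _).symm.trans (congrArg (f.P.map e.hom.map ≫ ·)
        ((f.P.map_comp_assoc _ _ _).symm.trans hm))⟩
    ext
    exact this

end ConfP

/-! ### The lift to the category of adjunctions -/

namespace AdjuS

/-- A morphism of adjunctions is determined by its restriction to the right adjoints. -/
instance : rightAdjoint.{v₁, v₂, u₁, u₂}.Faithful where
  map_injective {X Y} f g h := by
    obtain ⟨U, V, α, β, hu, _⟩ := f
    obtain ⟨U', V', α', β', hu', _⟩ := g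
    obtain ⟨rfl, rfl, rfl⟩ : V = V' ∧ U = U' ∧ β ≍ β' := by
      exact FunS.Hom.mk.inj h
    -- The unit equation fixes the transpose of each component of `α`.
    have : α = α' := by
      ext A
      refine (Y.adj.homEquiv _ _).injective ?_
      rw [Y.adj.homEquiv_unit, Y.adj.homEquiv_unit]
      exact (hu A).symm.trans (hu' A)
    subst this
    rfl

/-- A square of right adjoints underlies a morphism of adjunctions if the functor between the
sources of the right adjoints preserves the universal property of the unit. -/
theorem exists_hom {X Y : AdjuS.{v₁, v₂, u₁, u₂}} (U : X.C ⥤ Y.C) (V : X.D ⥤ Y.D)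
    (β : X.G ⋙ U ≅ V ⋙ Y.G)
    (h : ∀ (A : X.C) (B : Y.D) (g : U.obj A ⟶ Y.G.obj B),
      ∃! m : V.obj (X.F.obj A) ⟶ B,
        U.map (X.adj.unit.app A) ≫ β.hom.app (X.F.obj A) ≫ Y.G.map m = g) :
    ∃ f : X ⟶ Y, rightAdjoint.map f = ⟨V, U, β⟩ := by
  obtain ⟨u, hu⟩ : ∃ u : ∀ A, A ⟶ X.G.obj (X.F.obj A), ∀ A, X.adj.unit.app A = u A :=
    ⟨_, fun _ => rfl⟩
  obtain ⟨y, hy⟩ : ∃ y : ∀ A, A ⟶ Y.G.obj (Y.F.obj A), ∀ A, Y.adj.unit.app A = y A :=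
    ⟨_, fun _ => rfl⟩
  obtain ⟨b, hb⟩ : ∃ b : ∀ B, U.obj (X.G.obj B) ⟶ Y.G.obj (V.obj B), ∀ B, β.hom.app B = b B :=
    ⟨_, fun _ => rfl⟩
  have hu_nat {A B : X.C} (m : A ⟶ B) : m ≫ u B = u A ≫ X.G.map (X.F.map m) := by
    rw [← hu, ← hu]; exact X.adj.unit.naturality m
  have hy_nat {A B : Y.C} (m : A ⟶ B) : m ≫ y B = y A ≫ Y.G.map (Y.F.map m) := by
    rw [← hy, ← hy]; exact Y.adj.unit.naturality m
  have hb_nat {A B : X.D} (m : A ⟶ B) :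
      U.map (X.G.map m) ≫ b B = b A ≫ Y.G.map (V.map m) := by
    rw [← hb, ← hb]; exact β.hom.naturality m
  have hX (B : X.D) : u (X.G.obj B) ≫ X.G.map (X.adj.counit.app B) = 𝟙 _ := by
    rw [← hu]; exact X.adj.right_triangle_components B
  have hY (B : Y.D) : y (Y.G.obj B) ≫ Y.G.map (Y.adj.counit.app B) = 𝟙 _ := by
    rw [← hy]; exact Y.adj.right_triangle_components B
  have hext {A : Y.C} {B : Y.D} {m n : Y.F.obj A ⟶ B} (e : y A ≫ Y.G.map m = y A ≫ Y.G.map n) :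
      m = n := by
    refine (Y.adj.homEquiv _ _).injective ?_
    rw [Y.adj.homEquiv_unit, Y.adj.homEquiv_unit, hy]
    exact e
  -- The component of `α` at `A` is the transpose of the image of the unit. It is invertible since
  -- both sides represent maps from `U A` to `Y.G`.
  have hex (A : X.C) : ∃ t : Y.F.obj (U.obj A) ⟶ V.obj (X.F.obj A),
      y (U.obj A) ≫ Y.G.map t = U.map (u A) ≫ b (X.F.obj A) := by
    refine ⟨(Y.adj.homEquiv _ _).symm (U.map (u A) ≫ b (X.F.obj A)), ?_⟩
    rw [← hy]
    exact (Y.adj.homEquiv_unit _ _ _).symm.trans (Equiv.apply_symm_apply _ _)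
  choose t ht using hex
  have h' (A : X.C) (B : Y.D) (g : U.obj A ⟶ Y.G.obj B) :
      ∃! m : V.obj (X.F.obj A) ⟶ B, U.map (u A) ≫ b (X.F.obj A) ≫ Y.G.map m = g := by
    rw [← hu, ← hb]
    exact h A B g
  have hiso (A : X.C) : IsIso (t A) := by
    obtain ⟨r, hr, -⟩ := h' A _ (y (U.obj A))
    refine ⟨r, hext ?_, (h' A _ _).unique (y₁ := r ≫ t A) (y₂ := 𝟙 _) rfl ?_⟩
    · rw [Y.G.map_comp, reassoc_of% (ht A), hr, Y.G.map_id, Category.comp_id]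
    · rw [Y.G.map_comp, reassoc_of% hr, ht, Y.G.map_id, Category.comp_id]
  let α : U ⋙ Y.F ≅ X.F ⋙ V := NatIso.ofComponents (fun A => asIso (t A)) fun {A B} m => by
    change Y.F.map (U.map m) ≫ t B = t A ≫ V.map (X.F.map m)
    refine hext ?_
    rw [Y.G.map_comp, ← reassoc_of% (hy_nat (U.map m)), ht, ← U.map_comp_assoc, hu_nat,
      U.map_comp_assoc, hb_nat, Y.G.map_comp, reassoc_of% (ht A)]
  refine ⟨⟨U, V, α, β, fun A => ?_, fun B => ?_⟩, rfl⟩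
  · rw [hu, hy, hb]
    exact (ht A).symm
  · rw [hb]
    change t (X.G.obj B) ≫ V.map (X.adj.counit.app B) = Y.F.map (b B) ≫ Y.adj.counit.app (V.obj B)
    refine hext ?_
    have e₁ : U.map (u (X.G.obj B)) ≫ U.map (X.G.map (X.adj.counit.app B)) ≫ b B = b B := by
      rw [← U.map_comp_assoc, hX, U.map_id, Category.id_comp]
    have e₂ : y (U.obj (X.G.obj B)) ≫ Y.G.map (t (X.G.obj B) ≫ V.map (X.adj.counit.app B)) =
        b B := by
      rw [Y.G.map_comp, reassoc_of% (ht (X.G.obj B))]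
      exact (congrArg (U.map (u (X.G.obj B)) ≫ ·) (hb_nat (X.adj.counit.app B)).symm).trans e₁
    rw [e₂, Y.G.map_comp, ← reassoc_of% (hy_nat (b B)), hY, Category.comp_id]

end AdjuS

namespace ConfP

variable {κ : Ordinal.{w}}

/-- Every configuration has free algebras, and every morphism of configurations preserves
them. -/
theorem exists_adjunction (hκ : Order.IsSuccLimit κ) (X : ConfP.{w, v, u} κ) :
    ∃ (L : X.E ⥤ PtAlg X.η) (adj : L ⊣ PtAlg.forget X.η),
      ∀ (Y : ConfP.{w, v, u} κ) (f : X ⟶ Y) (A : X.E) (B : PtAlg Y.η)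
        (h : f.P.obj A ⟶ B.obj.a),
        ∃! m : f.algMap.obj (L.obj A) ⟶ B, f.P.map (adj.unit.app A) ≫ m.hom.f = h := by
  choose L ι hL using exists_freeAlgebra hκ X
  -- Freeness is the case of the identity morphism. Its action on algebras composes the structure
  -- map with an identity, so homomorphisms are transported along `e`.
  have hid (A : X.E) (B : PtAlg X.η) (h : A ⟶ B.obj.a) : ∃! m : L A ⟶ B, ι A ≫ m.hom.f = h := by
    obtain ⟨m, hm, hu⟩ := hL A X (Hom.id X) B h
    have e : ((Hom.id X).algMap.obj (L A)).obj.str = (L A).obj.str := Category.id_comp _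
    refine ⟨ObjectProperty.homMk ⟨m.hom.f, m.hom.h.trans (congrArg (· ≫ m.hom.f) e)⟩, hm,
      fun n hn => ?_⟩
    ext
    exact congrArg (fun k => k.hom.f) (hu (ObjectProperty.homMk
      ⟨n.hom.f, n.hom.h.trans (congrArg (· ≫ n.hom.f) e.symm)⟩) hn)
  choose d hd hu using hid
  let e (A : X.E) (B : PtAlg X.η) : (L A ⟶ B) ≃ (A ⟶ (PtAlg.forget X.η).obj B) :=
    { toFun := fun m => ι A ≫ m.hom.f
      invFun := d A B
      left_inv := fun m => (hu A B _ m rfl).symm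
      right_inv := hd A B }
  have he (A : X.E) (B B' : PtAlg X.η) (m : B ⟶ B') (k : L A ⟶ B) :
      e A B' (k ≫ m) = e A B k ≫ (PtAlg.forget X.η).map m := (Category.assoc _ _ _).symm
  refine ⟨_, Adjunction.adjunctionOfEquivLeft e he, fun Y f A B h => ?_⟩
  have : (Adjunction.adjunctionOfEquivLeft e he).unit.app A = ι A := by
    refine Eq.trans ?_ (Category.comp_id (ι A))
    exact Adjunction.mkOfHomEquiv_unit_app _ A
  rw [this]
  exact hL A Y f B h

end ConfP

theorem mainTheorem4 (κ : Ordinal.{w}) (hω : Ordinal.omega0 ≤ κ) (hκ : κ.cof.ord = κ) :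
    ∃ L : ConfP.{w, v, u} κ ⥤ AdjuS.{v, v, u, max u v},
      L ⋙ AdjuS.rightAdjoint = ConfP.forgetAlg κ := by
  -- Regularity identifies `κ` with the initial ordinal of its cofinality, an infinite cardinal,
  -- hence with a limit ordinal.
  have hlim : Order.IsSuccLimit κ := by
    rw [← hκ]
    refine Cardinal.isSuccLimit_ord (Cardinal.ord_le_ord.1 ?_)
    rwa [hκ, Cardinal.ord_aleph0]
  choose L adj h using ConfP.exists_adjunction.{w, v, u} hlim
  let obj (X : ConfP.{w, v, u} κ) : AdjuS.{v, v, u, max u v} :=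
    ⟨X.E, PtAlg X.η, L X, PtAlg.forget X.η, adj X⟩
  have hmap {X Y : ConfP.{w, v, u} κ} (f : X ⟶ Y) :
      ∃ g : obj X ⟶ obj Y, AdjuS.rightAdjoint.map g = (ConfP.forgetAlg κ).map f :=
    AdjuS.exists_hom (X := obj X) (Y := obj Y) f.P f.algMap (Iso.refl _) fun A B g => by
      refine (existsUnique_congr fun m => ?_).2 (h X Y f A B g)
      exact Eq.congr_left (congrArg (f.P.map _ ≫ ·) (Category.id_comp _))
  -- The lifts are chosen arbitrarily; the functor laws hold after restriction to right adjoints,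
  -- and faithfulness reflects them.
  choose map hmap using @hmap
  refine ⟨{ obj := obj, map := map, map_id := fun X => ?_, map_comp := fun f g => ?_ }, ?_⟩
  · refine AdjuS.rightAdjoint.map_injective ?_
    exact (hmap _).trans (((ConfP.forgetAlg κ).map_id X).trans
      (AdjuS.rightAdjoint.map_id (obj X)).symm)
  · refine AdjuS.rightAdjoint.map_injective ?_
    exact (hmap _).trans (((ConfP.forgetAlg κ).map_comp f g).trans
      ((congrArg₂ (· ≫ ·) (hmap f) (hmap g)).symm.trans (AdjuS.rightAdjoint.map_comp _ _).symm))
  · exact CategoryTheory.Functor.hext (fun X => rfl) fun X Y f => heq_of_eq (hmap f)
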